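/- For real $\alpha>0$ and $\beta\ge 0$ let $\mathcal B(\alpha,\beta)=\{\lfloor n\alpha+\beta\rfloor : n=1,2,3,\dots\}$. An irrational number $\gamma$ is of finite type $t$ if $t=\sup\{\rho\in\mathbb R:\liminf_{n\to\infty}n^{\rho}\|n\gamma\|=0\}$ (a finite supremum), where $\|x\|$ is the distance from $x$ to the nearest integer. Sums over $p$ run over primes. Let $\alpha>1$ be irrational. For every $\varepsilon>0$, every real $\beta\ge 0$, all positive integers $N\ge 3$, $q$, $d$, $f$ with $1\le f<d\le\min\{q^{1/2},N^{1/6}\}$ and $(f,d)=1$, and every non-negative integer $a$ with $(a,q)=1$ and $\left|\frac1\alpha-\frac aq\right|\le\frac1{q^2}$, $$\sum_{\substack{p\le N\\ p\in\mathcal B(\alpha,\beta)\\ p\equiv f\,(\mathrm{mod}\ d)}}\log p=\frac1\alpha\sum_{\substack{p\le N\\ p\equiv f\,(\mathrm{mod}\ d)}}\log p+O\left(N^{\varepsilon}\left(\frac{N}{q^{1/2}}+N^{1/2}q^{1/2}+N^{3/4}d^{1/2}+\frac{N^{4/5}}{d^{1/5}}\right)+\beta\right).$$ Furthermore, if $\frac1\alpha$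 is of finite type $t$, then for every $0<\varepsilon<\frac1{4(t+1)}$, every real $\beta\ge0$, and all integers $N\ge3$, $1\le f<d\le\min\{N^{\frac1{2(t+1)}},N^{1/6}\}$ with $(f,d)=1$, $$\sum_{\substack{p\le N\\ p\in\mathcal B(\alpha,\beta)\\ p\equiv f\,(\mathrm{mod}\ d)}}\log p=\frac1\alpha\sum_{\substack{p\le N\\ p\equiv f\,(\mathrm{mod}\ d)}}\log p+O\left(N^{1-\frac1{2(1+t)}+\varepsilon}+N^{\frac34+\varepsilon}d^{1/2}+N^{\frac45+\varepsilon}d^{-1/5}+\beta\right).$$ In both formulas the implied constant depends only on $\alpha$ and $\varepsilon$; it is uniform in $\beta,N,f,d,a,q$. In particular, for $\beta$ in a bounded range the term $\beta$ may be omitted. -/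

import Mathlib

open Filter

noncomputable section

/-- The (non-homogeneous) Beatty sequence `{⌊n α + β⌋ : n = 1, 2, 3, …}`, as a set of integers. -/
def beatty (α β : ℝ) : Set ℤ :=
  {m : ℤ | ∃ n : ℕ, 1 ≤ n ∧ m = ⌊(n : ℝ) * α + β⌋}

/-- The distance from a real number to the nearest integer. -/
def distNearestInt (x : ℝ) : ℝ := |x - (round x : ℝ)|

/-- `γ` is an irrational number of finite type `t`: the (finite) supremum of all real `ρ` with
`liminf n ^ ρ * ‖n γ‖ = 0` equals `t`. The lower limit is taken in `[0, ∞]`, because the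
sequence need not be bounded. -/
def IsOfFiniteType (γ t : ℝ) : Prop :=
  Irrational γ ∧
    IsLUB {ρ : ℝ | liminf
      (fun n : ℕ => ENNReal.ofReal ((n : ℝ) ^ ρ * distNearestInt ((n : ℝ) * γ))) atTop = 0} t

/-- The sum of `log p` over the primes `p ≤ N` with `p ≡ f (mod d)`. -/
def primeSum (N f d : ℕ) : ℝ :=
  ∑ p ∈ (Finset.Icc 1 N).filter (fun p : ℕ => p.Prime ∧ p ≡ f [MOD d]), Real.log p

open scoped Classical in
/-- The sum of `log p` over the primes `p ≤ N` with `p ∈ 𝓑(α, β)` and `p ≡ f (mod d)`. -/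
def beattyPrimeSum (α β : ℝ) (N f d : ℕ) : ℝ :=
  ∑ p ∈ (Finset.Icc 1 N).filter
    (fun p : ℕ => p.Prime ∧ (p : ℤ) ∈ beatty α β ∧ p ≡ f [MOD d]), Real.log p

end

/-! Put γ = 1/α. Solving m ≤ nα + β < m + 1 for -n shows that, for m > β, membership of m in the
Beatty sequence means that the half-open interval (γ(β - 1) - γm, γβ - γm] of length γ < 1 contains
an integer. The indicator is thus a difference of two floors: it equals γ plus a difference of two
sawtooth values. Primes p ≤ β cost O(β) by Chebyshev. It remains to bound sums of log p against the
sawtooth at -γp + c.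

The floor is a slope of a convex piecewise linear function, so difference quotients of that function
at step δ bound the floor from both sides. The periodic part of the function is a quadratic
Bernoulli polynomial, whose Fourier series converges absolutely. Hence the sawtooth sum is
controlled by the sum over k of |S(γk)|/k, where S is the exponential sum over primes in the residue
class (`abs_sum_floor_sub_le`, `abs_beattyPrimeSum_sub_le`).

The sums S(γk) are bounded on average over k ≤ H. Vaughan's identity splits the von Mangoldt
function into Type I and Type II parts (`ExpSumData.typeI`, `ExpSumData.typeII`). The class modulo d
turns inner sums into geometric progressions of step d, so both types reduce to sums of min(Z,
1/‖γkdy‖). Grouping by x = kdy costs a divisor function and leaves the classical sum over x, which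
needs a rational approximation a/q to γ alone. The averaging over k removes any need to approximate
each multiple γk. Choosing the cutoff U in Vaughan's identity near N^(2/5) d^(-3/5) yields the four
error terms (`exists_vaughan_cutoff`).

For γ of finite type t, Dirichlet's theorem at level N^(t/(t+1)) gives a denominator q that the type
forces to be at least about N^(1/(t+1)). The two terms containing q are then both of the required
size (`exists_expSumError_le_of_isOfFiniteType`). -/

/-! ### Additive characters and the distance to the nearest integer -/

/-- The additive character `x ↦ e^{2πix}` of the reals. -/
noncomputable def expi (x : ℝ) : ℂ := Complex.exp ((2 * Real.pi * x : ℝ) * Complex.I)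

theorem expi_add (x y : ℝ) : expi (x + y) = expi x * expi y := by
  simp only [expi, ← Complex.exp_add]
  congr 1; push_cast; ring

theorem norm_expi (x : ℝ) : ‖expi x‖ = 1 := Complex.norm_exp_ofReal_mul_I _

theorem expi_nat_mul (x : ℝ) (n : ℕ) : expi (x * n) = expi x ^ n := by
  simp only [expi, ← Complex.exp_nat_mul]
  congr 1; push_cast; ring

theorem conj_expi (x : ℝ) : (starRingEnd ℂ) (expi x) = expi (-x) := by
  simp only [expi, ← Complex.exp_conj]
  congr 1
  rw [map_mul, Complex.conj_ofReal, Complex.conj_I]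
  push_cast; ring

theorem expi_re (x : ℝ) : (expi x).re = Real.cos (2 * Real.pi * x) := Complex.exp_ofReal_mul_I_re _

theorem distNearestInt_nonneg (x : ℝ) : 0 ≤ distNearestInt x := abs_nonneg _

theorem distNearestInt_le (x : ℝ) (z : ℤ) : distNearestInt x ≤ |x - z| := round_le x z

theorem distNearestInt_neg (x : ℝ) : distNearestInt (-x) = distNearestInt x := by
  apply le_antisymm
  · refine (distNearestInt_le (-x) (-round x)).trans_eq ?_
    rw [distNearestInt, ← abs_neg]; congr 1; push_cast; ring
  · refine (distNearestInt_le x (-round (-x))).trans_eq ?_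
    rw [distNearestInt, ← abs_neg]; congr 1; push_cast; ring

theorem distNearestInt_pos {x : ℝ} (hx : Irrational x) : 0 < distNearestInt x :=
  abs_pos.2 (sub_ne_zero.2 (hx.ne_int _))

/-- Here |1 - e(x)| = 2|sin πx|, and Jordan's inequality bounds the sine below on [-π/2, π/2]. -/
theorem four_mul_distNearestInt_le (x : ℝ) : 4 * distNearestInt x ≤ ‖1 - expi x‖ := by
  have h1 : ‖1 - expi x‖ = 2 * |Real.sin (Real.pi * x)| := by
    rw [norm_sub_rev, expi, mul_comm, Complex.norm_exp_I_mul_ofReal_sub_one, Real.norm_eq_abs,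
      abs_mul, abs_two]
    congr 3; ring
  have h2 : |Real.sin (Real.pi * x)| = |Real.sin (Real.pi * (x - round x))| := by
    rw [mul_sub, mul_comm _ (round x : ℝ), Real.sin_sub_int_mul_pi, abs_mul]
    simp
  have h3 : 2 / Real.pi * |Real.pi * (x - round x)| ≤ |Real.sin (Real.pi * (x - round x))| := by
    apply Real.mul_abs_le_abs_sin
    rw [abs_mul, abs_of_pos Real.pi_pos]
    have := abs_sub_round x
    nlinarith [Real.pi_pos]
  rw [abs_mul, abs_of_pos Real.pi_pos] at h3
  have h4 : 2 / Real.pi * (Real.pi * |x - round x|) = 2 * |x - round x| := by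
    field_simp
  rw [h1, h2, distNearestInt]
  linarith

theorem norm_sum_range_expi_le (θ : ℝ) (hθ : 0 < distNearestInt θ) (n : ℕ) :
    ‖∑ j ∈ Finset.range n, expi (θ * j)‖ ≤ min (n : ℝ) (1 / distNearestInt θ) := by
  apply le_min
  · refine (norm_sum_le _ _).trans ?_
    simp [norm_expi]
  · have h1 := mul_neg_geom_sum (expi θ) n
    have h2 := four_mul_distNearestInt_le θ
    simp only [expi_nat_mul]
    rw [le_div_iff₀ hθ]
    have h3 : ‖1 - expi θ‖ * ‖∑ j ∈ Finset.range n, expi θ ^ j‖ ≤ 2 := by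
      rw [← norm_mul, h1]
      refine (norm_sub_le _ _).trans ?_
      rw [norm_pow, norm_expi]; norm_num
    nlinarith [norm_nonneg (∑ j ∈ Finset.range n, expi θ ^ j)]

/-! ### Exponential sums over a residue class -/

/-- A predicate describing a residue class modulo `d` (or nothing) cuts an arithmetic progression
out of an initial segment. -/
theorem exists_filter_range_eq_image (d Y : ℕ) (hd : 0 < d) (P : ℕ → Prop) [DecidablePred P]
    (hP : ∀ a b, P a → (P b ↔ a ≡ b [MOD d])) :
    ∃ r n : ℕ, (n : ℝ) ≤ (Y : ℝ) / d + 1 ∧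
      (Finset.range Y).filter P = (Finset.range n).image (fun j => r + d * j) := by
  by_cases hne : ∃ a, P a
  swap
  · refine ⟨0, 0, by rw [Nat.cast_zero]; positivity, ?_⟩
    rw [Finset.filter_false_of_mem (fun x _ h => hne ⟨x, h⟩)]
    simp
  obtain ⟨a, ha⟩ := hne
  set r := a % d with hr
  have hrd : r < d := Nat.mod_lt _ hd
  -- This is ⌈(Y - r)/d⌉, the number of j with r + dj < Y.
  set n := (Y + d - 1 - r) / d with hn
  refine ⟨r, n, ?_, ?_⟩
  · have h5 : n * d ≤ Y + d := by
      have := Nat.div_mul_le_self (Y + d - 1 - r) d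
      rw [← hn] at this
      omega
    have hd' : (0 : ℝ) < d := by exact_mod_cast hd
    rw [div_add_one hd'.ne', le_div_iff₀ hd']
    exact_mod_cast h5
  ext l
  simp only [Finset.mem_filter, Finset.mem_range, Finset.mem_image, hP a l ha]
  constructor
  · rintro ⟨h1, h2⟩
    have h2' : l % d = r := h2.symm
    have h3 := Nat.mod_add_div l d
    refine ⟨l / d, ?_, by rw [← h2']; exact h3⟩
    rw [hn, Nat.lt_div_iff_mul_lt hd]
    rw [h2'] at h3
    have : l / d * d = d * (l / d) := mul_comm _ _
    omega
  · rintro ⟨j, hj, rfl⟩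
    refine ⟨?_, ?_⟩
    · rw [hn, Nat.lt_div_iff_mul_lt hd] at hj
      have : j * d = d * j := mul_comm _ _
      omega
    · have : (r + d * j) % d = r := by
        rw [Nat.add_mul_mod_self_left, Nat.mod_eq_of_lt hrd]
      exact this.symm

theorem sum_Icc_one_eq_sum_range (F : ℕ → ℂ) (Y : ℕ) :
    ∑ l ∈ Finset.Icc 1 Y, F l = ∑ l ∈ Finset.range Y, F (l + 1) := by
  rw [Finset.range_eq_Ico, Finset.sum_Ico_add' F 0 Y 1]
  rfl

/-- An exponential sum over a residue class (or the empty set), described by a predicate. -/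
theorem norm_sum_expi_residue_le (θ : ℝ) (d Y : ℕ) (hd : 0 < d) (P : ℕ → Prop) [DecidablePred P]
    (hP : ∀ a b, P a → (P b ↔ a ≡ b [MOD d])) :
    ‖∑ l ∈ Finset.Icc 1 Y, (if P l then expi (θ * l) else 0)‖ ≤ (Y : ℝ) / d + 1 ∧
    (0 < distNearestInt (θ * d) → ‖∑ l ∈ Finset.Icc 1 Y, (if P l then expi (θ * l) else 0)‖ ≤
      1 / distNearestInt (θ * d)) := by
  rw [sum_Icc_one_eq_sum_range]
  obtain ⟨r, n, hn, himg⟩ := exists_filter_range_eq_image d Y hd (fun l => P (l + 1)) (by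
    intro a b ha
    rw [hP _ _ ha]
    exact ⟨fun h => Nat.ModEq.add_right_cancel' 1 h, fun h => h.add_right 1⟩)
  rw [← Finset.sum_filter, himg, Finset.sum_image (by
    intro x _ y _ h
    exact Nat.eq_of_mul_eq_mul_left hd (Nat.add_left_cancel h))]
  have h4 : ∀ j : ℕ, expi (θ * ((r + d * j + 1 : ℕ) : ℝ)) =
      expi (θ * (r + 1)) * expi (θ * d * j) := by
    intro j; rw [← expi_add]; congr 1; push_cast; ring
  simp only [h4]
  rw [← Finset.mul_sum, norm_mul, norm_expi, one_mul]
  constructor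
  · refine (norm_sum_le _ _).trans (le_trans ?_ hn)
    simp [norm_expi]
  · intro hθ
    exact (norm_sum_range_expi_le _ hθ n).trans (min_le_right _ _)

/-! ### Sums of min(Z, 1/‖θx‖) -/

theorem sum_one_div_le_one_add_log (q : ℕ) :
    ∑ j ∈ Finset.Icc 1 q, 1 / (j : ℝ) ≤ 1 + Real.log q := by
  have h := harmonic_le_one_add_log q
  rw [harmonic_eq_sum_Icc] at h
  push_cast at h
  simpa [one_div] using h

/-- If the points `u x` have absolute value at most `1/2`, the same sign, and are `1/(2q)`-spaced,
then `∑ min(Z, 1/|u x|) ≤ Z + 2q(1 + log q)`. -/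
theorem sum_min_inv_abs_le_of_spaced (s : Finset ℕ) (u : ℕ → ℝ) (q : ℕ) (hq : 0 < q)
    (Z : ℝ) (hZ : 0 ≤ Z) (hu : ∀ x ∈ s, |u x| ≤ 1 / 2)
    (hsp : ∀ x ∈ s, ∀ y ∈ s, x ≠ y → 1 / (2 * (q : ℝ)) ≤ |(|u x| - |u y|)|) :
    ∑ x ∈ s, min Z (1 / |u x|) ≤ Z + 2 * q * (1 + Real.log q) := by
  have hq' : (0 : ℝ) < q := by exact_mod_cast hq
  -- Cut [0, 1/2] into cells of length 1/(2q). The spacing puts at most one point in each cell; cell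
  -- 0 pays Z, and cell j pays 2q/j.
  let fl : ℕ → ℕ := fun x => ⌊|u x| * (2 * q)⌋₊
  let g : ℕ → ℝ := fun j => if j = 0 then Z else 2 * q * (1 / (j : ℝ))
  have hg : ∀ j, 0 ≤ g j := by
    intro j
    simp only [g]
    split_ifs
    · exact hZ
    · positivity
  have hle : ∀ x ∈ s, min Z (1 / |u x|) ≤ g (fl x) := by
    intro x _
    simp only [g]
    split_ifs with h
    · exact min_le_left _ _
    · refine (min_le_right _ _).trans ?_
      have h1 : (fl x : ℝ) ≤ |u x| * (2 * q) := Nat.floor_le (by positivity)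
      have h2 : (0 : ℝ) < fl x := by exact_mod_cast Nat.pos_of_ne_zero h
      have h3 : 0 < |u x| := by
        by_contra hc
        have : |u x| = 0 := le_antisymm (not_lt.1 hc) (abs_nonneg _)
        rw [this] at h1; linarith
      rw [div_le_iff₀ h3, mul_one_div, div_mul_eq_mul_div, le_div_iff₀ h2]
      linarith
  have hinj : Set.InjOn fl s := by
    intro x hx y hy hxy
    by_contra hne
    have h1 := hsp x hx y hy hne
    have hx1 : (fl x : ℝ) ≤ |u x| * (2 * q) := Nat.floor_le (by positivity)
    have hy1 : (fl y : ℝ) ≤ |u y| * (2 * q) := Nat.floor_le (by positivity)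
    have hx2 : |u x| * (2 * q) < fl x + 1 := Nat.lt_floor_add_one _
    have hy2 : |u y| * (2 * q) < fl y + 1 := Nat.lt_floor_add_one _
    have hxy' : (fl x : ℝ) = fl y := by exact_mod_cast hxy
    have h2 : |(|u x| - |u y|)| * (2 * q) < 1 := by
      have h3 : (0 : ℝ) < 2 * q := by positivity
      rw [show |(|u x| - |u y|)| * (2 * (q : ℝ)) = |(|u x| - |u y|) * (2 * (q : ℝ))| by
        rw [abs_mul _ (2 * (q : ℝ)), abs_of_pos h3], abs_lt, sub_mul]
      constructor <;> linarith
    rw [div_le_iff₀ (by positivity)] at h1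
    linarith
  have hmem : s.image fl ⊆ insert 0 (Finset.Icc 1 q) := by
    intro j hj
    obtain ⟨x, hx, rfl⟩ := Finset.mem_image.1 hj
    have : fl x ≤ q := by
      apply Nat.floor_le_of_le
      nlinarith [hu x hx]
    simp only [Finset.mem_insert, Finset.mem_Icc]
    omega
  calc ∑ x ∈ s, min Z (1 / |u x|) ≤ ∑ x ∈ s, g (fl x) := Finset.sum_le_sum hle
    _ = ∑ j ∈ s.image fl, g j := (Finset.sum_image hinj).symm
    _ ≤ ∑ j ∈ insert 0 (Finset.Icc 1 q), g j :=
        Finset.sum_le_sum_of_subset_of_nonneg hmem (fun j _ _ => hg j)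
    _ = Z + ∑ j ∈ Finset.Icc 1 q, g j := by
        rw [Finset.sum_insert (by simp)]; simp [g]
    _ = Z + 2 * q * ∑ j ∈ Finset.Icc 1 q, 1 / (j : ℝ) := by
        rw [Finset.mul_sum]
        congr 1
        apply Finset.sum_congr rfl
        intro j hj
        have : j ≠ 0 := by have := (Finset.mem_Icc.1 hj).1; omega
        simp [g, this]
    _ ≤ _ := by gcongr; exact sum_one_div_le_one_add_log q

/-- Points are split by the sign of v - round v. Within one sign, spacing modulo 1 implies spacing
of absolute values, so each sign contributes at most Z + 2q(1 + log q). -/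
theorem sum_min_inv_distNearestInt_le_of_spaced (s : Finset ℕ) (v : ℕ → ℝ) (q : ℕ) (hq : 0 < q)
    (Z : ℝ) (hZ : 0 ≤ Z)
    (hsp : ∀ x ∈ s, ∀ y ∈ s, x ≠ y → 1 / (2 * (q : ℝ)) ≤ distNearestInt (v x - v y)) :
    ∑ x ∈ s, min Z (1 / distNearestInt (v x)) ≤ 2 * Z + 4 * q * (1 + Real.log q) := by
  let u : ℕ → ℝ := fun x => v x - round (v x)
  have hd : ∀ x y, distNearestInt (v x - v y) ≤ |u x - u y| := by
    intro x y
    refine (distNearestInt_le _ (round (v x) - round (v y))).trans_eq ?_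
    congr 1; simp only [u]; push_cast; ring
  rw [← Finset.sum_filter_add_sum_filter_not s (fun x => 0 ≤ u x)]
  have h1 := sum_min_inv_abs_le_of_spaced (s.filter (fun x => 0 ≤ u x)) u q hq Z hZ
    (fun x _ => abs_sub_round _) (by
      intro x hx y hy hxy
      rw [Finset.mem_filter] at hx hy
      rw [abs_of_nonneg hx.2, abs_of_nonneg hy.2]
      exact (hsp x hx.1 y hy.1 hxy).trans (hd x y))
  have h2 := sum_min_inv_abs_le_of_spaced (s.filter (fun x => ¬ 0 ≤ u x)) u q hq Z hZ
    (fun x _ => abs_sub_round _) (by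
      intro x hx y hy hxy
      rw [Finset.mem_filter, not_le] at hx hy
      rw [abs_of_neg hx.2, abs_of_neg hy.2]
      refine ((hsp x hx.1 y hy.1 hxy).trans (hd x y)).trans_eq ?_
      rw [← abs_neg]; congr 1; ring)
  simp only [u] at h1 h2
  simp only [u, distNearestInt]
  linarith

/-- Multiples of a number close to `a / q` are spaced, as long as they are few. -/
theorem one_div_le_distNearestInt_mul (θ : ℝ) (a q : ℕ) (hq : 0 < q) (haq : Nat.Coprime a q)
    (hθ : |θ - (a : ℝ) / q| ≤ 1 / (q : ℝ) ^ 2) (z : ℤ) (hz : z ≠ 0) (hzq : 2 * |z| ≤ q) :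
    1 / (2 * (q : ℝ)) ≤ distNearestInt (θ * z) := by
  have hq' : (0 : ℝ) < q := by exact_mod_cast hq
  set n := round (θ * z) with hn
  have h1 : (a : ℤ) * z - n * q ≠ 0 := by
    intro h
    have hdvd : (q : ℤ) ∣ a * z := ⟨n, by linarith⟩
    have h2 : (q : ℤ) ∣ z :=
      (Int.isCoprime_iff_gcd_eq_one.2 (by simpa [Nat.coprime_comm] using haq) :
        IsCoprime (q : ℤ) a).dvd_of_dvd_mul_left hdvd
    have h3 := Int.le_of_dvd (abs_pos.2 hz) ((dvd_abs _ _).2 h2)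
    have := abs_pos.2 hz
    omega
  -- The nonzero integer az - nq has size at least 1. Replacing a/q by θ moves az by at most |z|/q²
  -- ≤ 1/(2q), which after scaling by q leaves at least half.
  have h2 : (1 : ℝ) ≤ |(a : ℝ) * z - n * q| := by
    have := Int.one_le_abs h1
    exact_mod_cast this
  have h3 : (a : ℝ) * z - n * q = (θ * z - n) * q - (θ - a / q) * z * q := by
    field_simp; ring
  have h4 : |(a : ℝ) * z - n * q| ≤ distNearestInt (θ * z) * q + |θ - a / q| * |(z : ℝ)| * q := by
    rw [h3]
    refine (abs_sub _ _).trans_eq ?_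
    rw [abs_mul, abs_mul, abs_mul, abs_of_pos hq', distNearestInt]
  have h5 : |(z : ℝ)| ≤ q / 2 := by
    have : (2 * |(z : ℝ)|) ≤ q := by exact_mod_cast hzq
    linarith
  have h6 : |θ - a / q| * |(z : ℝ)| * q ≤ 1 / (q : ℝ) ^ 2 * (q / 2) * q := by gcongr
  have h7 : 1 / (q : ℝ) ^ 2 * (q / 2) * q = 1 / 2 := by field_simp
  rw [div_le_iff₀ (by positivity)]
  linarith

/-- The standard estimate for `∑ min(Z, 1/‖θx‖)` over `1 ≤ x ≤ X`. -/
theorem sum_min_inv_distNearestInt_le (θ : ℝ) (a q : ℕ) (hq : 0 < q)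
    (haq : Nat.Coprime a q) (hθ : |θ - (a : ℝ) / q| ≤ 1 / (q : ℝ) ^ 2) (X : ℕ) (Z T : ℝ)
    (hZ : 0 ≤ Z) (hT : 1 + Real.log q ≤ T) :
    ∑ x ∈ Finset.Icc 1 X, min Z (1 / distNearestInt (θ * x)) ≤
      8 * T * (X * Z / q + X + q) := by
  have hq' : (0 : ℝ) < q := by exact_mod_cast hq
  have hT1 : 1 ≤ T := by
    have := Real.log_nonneg (show (1 : ℝ) ≤ q by exact_mod_cast hq)
    linarith
  -- Blocks of this length contain only differences of size at most q/2, the range in which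
  -- multiples of θ are known to be spaced.
  set b := q / 2 + 1 with hb
  have hb0 : 0 < b := by omega
  have hspace : ∀ x y : ℕ, x ≠ y → x / b = y / b →
      1 / (2 * (q : ℝ)) ≤ distNearestInt (θ * x - θ * y) := by
    intro x y hxy hdiv
    have h1 := Nat.div_add_mod x b
    have h2 := Nat.div_add_mod y b
    have h3 := Nat.mod_lt x hb0
    have h4 := Nat.mod_lt y hb0
    rw [hdiv] at h1
    have h5 := one_div_le_distNearestInt_mul θ a q hq haq hθ ((x : ℤ) - y) (by omega) (by
      have : |(x : ℤ) - y| ≤ (q / 2 : ℕ) := by rw [abs_le]; constructor <;> omega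
      omega)
    push_cast at h5
    rwa [mul_sub] at h5
  have hfib : ∀ W : ℝ, 0 ≤ W → ∀ i : ℕ,
      ∑ x ∈ (Finset.Icc 1 X).filter (fun x => x / b = i), min W (1 / distNearestInt (θ * x)) ≤
        2 * W + 4 * q * T := by
    intro W hW i
    refine (sum_min_inv_distNearestInt_le_of_spaced _ (fun x : ℕ => θ * x) q hq W hW ?_).trans ?_
    · intro x hx y hy hxy
      rw [Finset.mem_filter] at hx hy
      exact hspace x y hxy (hx.2.trans hy.2.symm)
    · gcongr
  -- In the block containing 0 every x ≥ 1 is also spaced from 0, so 1/‖θx‖ ≤ 2q and Z may be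
  -- replaced by 2q. This avoids a stray term Z when X is smaller than q.
  have hzero : ∑ x ∈ (Finset.Icc 1 X).filter (fun x => x / b = 0),
      min Z (1 / distNearestInt (θ * x)) ≤ 8 * q * T := by
    have h1 : ∀ x ∈ (Finset.Icc 1 X).filter (fun x => x / b = 0),
        min Z (1 / distNearestInt (θ * x)) ≤ min (2 * q : ℝ) (1 / distNearestInt (θ * x)) := by
      intro x hx
      rw [Finset.mem_filter, Finset.mem_Icc, Nat.div_eq_zero_iff] at hx
      refine le_min ((min_le_right _ _).trans ?_) (min_le_right _ _)
      have h2 := hspace x 0 (by omega) (by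
        rw [Nat.zero_div, Nat.div_eq_zero_iff]; omega)
      simp only [Nat.cast_zero, mul_zero, sub_zero] at h2
      rw [div_le_iff₀ (lt_of_lt_of_le (by positivity) h2)]
      rw [div_le_iff₀ (by positivity)] at h2
      linarith
    refine (Finset.sum_le_sum h1).trans ((hfib (2 * q) (by positivity) 0).trans ?_)
    nlinarith
  have hmaps : ∀ x ∈ Finset.Icc 1 X, x / b ∈ Finset.range (X / b + 1) := by
    intro x hx
    rw [Finset.mem_range, Nat.lt_succ_iff]
    exact Nat.div_le_div_right (Finset.mem_Icc.1 hx).2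
  rw [← Finset.sum_fiberwise_of_maps_to hmaps, Finset.sum_range_succ']
  have h2 : ∑ i ∈ Finset.range (X / b), ∑ x ∈ (Finset.Icc 1 X).filter (fun x => x / b = i + 1),
      min Z (1 / distNearestInt (θ * x)) ≤ (X / b : ℕ) * (2 * Z + 4 * q * T) := by
    refine (Finset.sum_le_card_nsmul _ _ _ (fun i _ => hfib Z hZ (i + 1))).trans_eq ?_
    rw [Finset.card_range, nsmul_eq_mul]
  have h3 : ((X / b : ℕ) : ℝ) ≤ 2 * X / q := by
    have hbq : (q : ℝ) / 2 ≤ b := by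
      have : q ≤ 2 * b := by omega
      have : (q : ℝ) ≤ 2 * b := by exact_mod_cast this
      linarith
    refine Nat.cast_div_le.trans ?_
    rw [div_le_div_iff₀ (by exact_mod_cast hb0) hq']
    nlinarith [(Nat.cast_nonneg X : (0 : ℝ) ≤ X)]
  have h4 : ((X / b : ℕ) : ℝ) * (2 * Z + 4 * q * T) ≤ 2 * X / q * (2 * Z + 4 * q * T) := by
    gcongr
  have h5 : 2 * X / q * (2 * Z + 4 * q * T) = 4 * (X * Z / q) + 8 * T * X := by
    field_simp; ring
  have h6 : 4 * (X * Z / q) ≤ 8 * T * (X * Z / q) := by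
    have : 0 ≤ X * Z / q := by positivity
    nlinarith
  linarith

/-! ### The divisor bound and sums over products -/

/-- The divisor function is `O(n ^ ε)`. -/
theorem exists_card_divisors_le_rpow (ε : ℝ) (hε : 0 < ε) :
    ∃ C : ℝ, 1 ≤ C ∧ ∀ n : ℕ, n ≠ 0 → (n.divisors.card : ℝ) ≤ C * (n : ℝ) ^ ε := by
  -- Primes p ≥ P satisfy p^ε ≥ 2, so a + 1 ≤ 2^a ≤ p^(aε) at no cost; each of the fewer than P
  -- smaller primes costs a factor c.
  set P := ⌈(2 : ℝ) ^ (1 / ε)⌉₊ with hP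
  set c : ℝ := 1 + 2 / ε with hc
  have hc1 : 1 ≤ c := by have : 0 < 2 / ε := by positivity
                         linarith
  have hexp : ∀ a : ℕ, (1 : ℝ) + a * ε / 2 ≤ 2 ^ (a * ε) := by
    intro a
    have h1 : (2 : ℝ) ^ (a * ε) = Real.exp (Real.log 2 * (a * ε)) := by
      rw [Real.rpow_def_of_pos (by norm_num)]
    have h2 := Real.add_one_le_exp (Real.log 2 * (a * ε))
    have h3 := Real.log_two_gt_d9
    have h4 : 0 ≤ a * ε := by positivity
    rw [h1]; nlinarith
  have key : ∀ p a : ℕ, p.Prime →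
      ((a + 1 : ℕ) : ℝ) ≤ (if p < P then c else 1) * ((p ^ a : ℕ) : ℝ) ^ ε := by
    intro p a hp
    have hp2 : (2 : ℝ) ≤ p := by exact_mod_cast hp.two_le
    have h0 : ((p ^ a : ℕ) : ℝ) ^ ε = (p : ℝ) ^ (a * ε) := by
      rw [Nat.cast_pow, ← Real.rpow_natCast, ← Real.rpow_mul (by positivity)]
    rw [h0]
    split_ifs with h
    · have h1 : (2 : ℝ) ^ (a * ε) ≤ (p : ℝ) ^ (a * ε) :=
        Real.rpow_le_rpow (by norm_num) hp2 (by positivity)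
      have h2 := hexp a
      have h3 : (a + 1 : ℝ) ≤ c * (1 + a * ε / 2) := by
        have h5 : c * (1 + a * ε / 2) = 1 + a * ε / 2 + 2 / ε + a := by
          rw [hc]; field_simp; ring
        rw [h5]
        have : 0 ≤ a * ε / 2 := by positivity
        have : 0 < 2 / ε := by positivity
        linarith
      push_cast
      refine h3.trans ?_
      gcongr
      linarith
    · rw [one_mul]
      have h1 : (2 : ℝ) ^ (1 / ε) ≤ p := (Nat.le_ceil _).trans (by exact_mod_cast not_lt.1 h)
      have h2 : (2 : ℝ) ≤ (p : ℝ) ^ ε := by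
        calc (2 : ℝ) = ((2 : ℝ) ^ (1 / ε)) ^ ε := by
              rw [← Real.rpow_mul (by norm_num), one_div_mul_cancel hε.ne', Real.rpow_one]
          _ ≤ _ := Real.rpow_le_rpow (by positivity) h1 hε.le
      rw [mul_comm, Real.rpow_mul (by positivity), Real.rpow_natCast]
      calc ((a + 1 : ℕ) : ℝ) ≤ (2 : ℝ) ^ a := by exact_mod_cast Nat.lt_two_pow_self
        _ ≤ _ := by gcongr
  refine ⟨c ^ P, one_le_pow₀ hc1, fun n hn => ?_⟩
  have h1 : ((n.primeFactors.prod fun p => (p ^ n.factorization p : ℕ) : ℕ) : ℝ) = n := by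
    exact_mod_cast Nat.prod_factorization_pow_eq_self hn
  rw [Nat.card_divisors hn]
  calc ((∏ x ∈ n.primeFactors, (n.factorization x + 1) : ℕ) : ℝ)
      = ∏ x ∈ n.primeFactors, ((n.factorization x + 1 : ℕ) : ℝ) := by push_cast; rfl
    _ ≤ ∏ x ∈ n.primeFactors,
        ((if x < P then c else 1) * ((x ^ n.factorization x : ℕ) : ℝ) ^ ε) :=
        Finset.prod_le_prod (fun _ _ => by positivity)
          (fun p hp => key p _ (Nat.prime_of_mem_primeFactors hp))
    _ = (∏ x ∈ n.primeFactors, (if x < P then c else 1)) * (n : ℝ) ^ ε := by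
        rw [Finset.prod_mul_distrib, Real.finsetProd_rpow _ _ (fun _ _ => by positivity),
          ← Nat.cast_prod, h1]
    _ ≤ c ^ P * (n : ℝ) ^ ε := by
        gcongr
        rw [← Finset.prod_filter, Finset.prod_const]
        apply pow_le_pow_right₀ hc1
        calc _ ≤ (Finset.range P).card := Finset.card_le_card (fun x hx => by
              simpa using (Finset.mem_filter.1 hx).2)
          _ = P := Finset.card_range P

/-- Sums over products `k * (d * y)`, controlled by a divisor bound. -/
theorem sum_sum_mul_le (G : ℕ → ℝ) (hG : ∀ x, 0 ≤ G x) (H Y d : ℕ) (hd : 0 < d) (T : ℝ)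
    (hT : ∀ x ∈ Finset.Icc 1 (H * (d * Y)), (x.divisors.card : ℝ) ≤ T) :
    ∑ k ∈ Finset.Icc 1 H, ∑ y ∈ Finset.Icc 1 Y, G (k * (d * y)) ≤
      T * ∑ x ∈ Finset.Icc 1 (H * (d * Y)), G x := by
  rw [← Finset.sum_product']
  have hmaps : ∀ z ∈ Finset.Icc 1 H ×ˢ Finset.Icc 1 Y,
      z.1 * (d * z.2) ∈ Finset.Icc 1 (H * (d * Y)) := by
    rintro ⟨k, y⟩ hz
    simp only [Finset.mem_product, Finset.mem_Icc] at hz ⊢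
    refine ⟨Nat.mul_pos hz.1.1 (Nat.mul_pos hd hz.2.1), ?_⟩
    gcongr
    · exact hz.1.2
    · exact hz.2.2
  rw [← Finset.sum_fiberwise_of_maps_to hmaps, Finset.mul_sum]
  apply Finset.sum_le_sum
  intro x hx
  have h1 : ∑ z ∈ (Finset.Icc 1 H ×ˢ Finset.Icc 1 Y).filter (fun z => z.1 * (d * z.2) = x),
      G (z.1 * (d * z.2)) =
      ((Finset.Icc 1 H ×ˢ Finset.Icc 1 Y).filter (fun z => z.1 * (d * z.2) = x)).card * G x := by
    rw [← nsmul_eq_mul, ← Finset.sum_const]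
    exact Finset.sum_congr rfl (fun z hz => by rw [(Finset.mem_filter.1 hz).2])
  rw [h1]
  refine mul_le_mul_of_nonneg_right (le_trans ?_ (hT x hx)) (hG x)
  have hx0 : x ≠ 0 := by have := (Finset.mem_Icc.1 hx).1; omega
  -- A pair in the fibre over x is determined by k, which is a divisor of x.
  exact_mod_cast Finset.card_le_card_of_injOn Prod.fst
    (by
      rintro ⟨k, y⟩ hz
      simp only [Finset.coe_filter, Set.mem_ofPred_eq] at hz
      simp only [Finset.mem_coe, Nat.mem_divisors]
      exact ⟨⟨_, hz.2.symm⟩, hx0⟩)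
    (by
      rintro ⟨k, y⟩ hz ⟨k', y'⟩ hz' (h : k = k')
      subst h
      simp only [Finset.coe_filter, Set.mem_ofPred_eq, Finset.mem_product, Finset.mem_Icc] at hz hz'
      have h2 := hz.2.trans hz'.2.symm
      have h3 := Nat.eq_of_mul_eq_mul_left hd (Nat.eq_of_mul_eq_mul_left hz.1.1.1 h2)
      rw [h3])

/-- The estimate for `∑ min(Z, 1/‖θkdy‖)` over `k ≤ H` and `y ≤ Y`. -/
theorem sum_sum_min_inv_distNearestInt_le (θ : ℝ) (a q : ℕ) (hq : 0 < q)
    (haq : Nat.Coprime a q) (hθ : |θ - (a : ℝ) / q| ≤ 1 / (q : ℝ) ^ 2) (H Y d : ℕ) (hd : 0 < d)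
    (Z T : ℝ) (hZ : 0 ≤ Z) (hT : 1 + Real.log q ≤ T)
    (hdiv : ∀ x ∈ Finset.Icc 1 (H * (d * Y)), (x.divisors.card : ℝ) ≤ T) :
    ∑ k ∈ Finset.Icc 1 H, ∑ y ∈ Finset.Icc 1 Y,
      min Z (1 / distNearestInt (θ * (k * (d * y) : ℕ))) ≤
      8 * T ^ 2 * (H * (d * Y) * Z / q + H * (d * Y) + q) := by
  have hT0 : 0 ≤ T := by
    have := Real.log_nonneg (show (1 : ℝ) ≤ q by exact_mod_cast hq)
    linarith
  refine (sum_sum_mul_le (fun x => min Z (1 / distNearestInt (θ * x)))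
    (fun x => le_min hZ (one_div_nonneg.2 (distNearestInt_nonneg _))) H Y d hd T hdiv).trans ?_
  have h := sum_min_inv_distNearestInt_le θ a q hq haq hθ (H * (d * Y)) Z T hZ hT
  push_cast at h
  calc _ ≤ T * (8 * T * (H * (d * Y) * Z / q + H * (d * Y) + q)) :=
        mul_le_mul_of_nonneg_left h hT0
    _ = _ := by ring

/-! ### The common setting of the exponential sum estimates -/

/-- `n ↦ e^{2πixn}` restricted to the residue class of `f` modulo `d`. -/
noncomputable def apPhase (f d : ℕ) (x : ℝ) (n : ℕ) : ℂ :=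
  if n ≡ f [MOD d] then expi (x * n) else 0

theorem norm_apPhase_le (f d : ℕ) (x : ℝ) (n : ℕ) : ‖apPhase f d x n‖ ≤ 1 := by
  unfold apPhase
  split_ifs <;> simp [norm_expi]

/-- The data of the exponential sum estimates: a rational approximation `a / q` of `θ`, a reduced
residue class `f` modulo `d`, a range `N`, a number `H` of frequencies, and a bound `T` for
logarithms and divisor functions. -/
structure ExpSumData (θ : ℝ) (N f d a q H : ℕ) (T : ℝ) : Prop where
  irr : Irrational θ
  two_le_N : 2 ≤ N
  d_pos : 0 < d
  d_le : d ≤ N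
  coprime_f : Nat.Coprime f d
  q_pos : 0 < q
  q_le : q ≤ N
  coprime_a : Nat.Coprime a q
  approx : |θ - (a : ℝ) / q| ≤ 1 / (q : ℝ) ^ 2
  H_pos : 0 < H
  H_le : H ≤ N ^ 2
  log_le : 1 + Real.log N ≤ T
  natLog_le : ((Nat.log 2 N : ℕ) : ℝ) + 1 ≤ T
  -- The exponent 5 covers products kdy with k ≤ N², d ≤ N and y ≤ N².
  divisors_le : ∀ x ∈ Finset.Icc 1 (N ^ 5), (x.divisors.card : ℝ) ≤ T

namespace ExpSumData

variable {θ : ℝ} {N f d a q H : ℕ} {T : ℝ}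

theorem one_le_T (D : ExpSumData θ N f d a q H T) : 1 ≤ T := by
  have := D.natLog_le
  have h : (0 : ℝ) ≤ (Nat.log 2 N : ℕ) := by positivity
  linarith

theorem dist_pos (D : ExpSumData θ N f d a q H T) {x : ℕ} (hx : 0 < x) :
    0 < distNearestInt (θ * x) :=
  distNearestInt_pos (D.irr.mul_natCast hx.ne')

theorem sum_sum_min_le (D : ExpSumData θ N f d a q H T) (Y : ℕ) (hY : Y ≤ N ^ 2)
    (Z : ℝ) (hZ : 0 ≤ Z) :
    ∑ k ∈ Finset.Icc 1 H, ∑ y ∈ Finset.Icc 1 Y,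
      min Z (1 / distNearestInt (θ * (k * (d * y) : ℕ))) ≤
      8 * T ^ 2 * (H * (d * Y) * Z / q + H * (d * Y) + q) := by
  refine sum_sum_min_inv_distNearestInt_le θ a q D.q_pos D.coprime_a D.approx H Y d D.d_pos Z T hZ
    ?_ ?_
  · refine le_trans ?_ D.log_le
    have : (0 : ℝ) < q := by exact_mod_cast D.q_pos
    gcongr
    exact_mod_cast D.q_le
  · intro x hx
    refine D.divisors_le x (Finset.Icc_subset_Icc_right ?_ hx)
    calc H * (d * Y) ≤ N ^ 2 * (N * N ^ 2) := by
          gcongr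
          · exact D.H_le
          · exact D.d_le
      _ = N ^ 5 := by ring

end ExpSumData

/-! ### Type I sums -/

/-- Partial summation against a monotone weight. -/
theorem norm_sum_monotone_mul_le (g : ℕ → ℝ) (hg : Monotone g) (hg0 : 0 ≤ g 0) (c : ℕ → ℂ) (B : ℝ)
    (hB : 0 ≤ B) (Y : ℕ) (hc : ∀ y ≤ Y, ‖∑ l ∈ Finset.Icc 1 y, c l‖ ≤ B) :
    ‖∑ l ∈ Finset.Icc 1 Y, (g l : ℂ) * c l‖ ≤ 2 * g Y * B := by
  -- The quantity inside changes by -(g(y+1) - g(y)) times a partial sum of c, so by monotonicity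
  -- the increments telescope to at most g(y)B.
  have key : ∀ y ≤ Y, ‖∑ l ∈ Finset.Icc 1 y, (g l : ℂ) * c l -
      g y * ∑ l ∈ Finset.Icc 1 y, c l‖ ≤ g y * B := by
    intro y
    induction y with
    | zero => intro _; simpa using mul_nonneg hg0 hB
    | succ y ih =>
      intro hy
      have h1 := ih (by omega)
      rw [Finset.sum_Icc_succ_top (by omega), Finset.sum_Icc_succ_top (by omega)]
      have h2 : ∑ l ∈ Finset.Icc 1 y, (g l : ℂ) * c l + g (y + 1) * c (y + 1) -
          g (y + 1) * (∑ l ∈ Finset.Icc 1 y, c l + c (y + 1)) =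
          (∑ l ∈ Finset.Icc 1 y, (g l : ℂ) * c l - g y * ∑ l ∈ Finset.Icc 1 y, c l) -
            ((g (y + 1) - g y : ℝ) : ℂ) * ∑ l ∈ Finset.Icc 1 y, c l := by
        push_cast; ring
      rw [h2]
      refine (norm_sub_le _ _).trans ?_
      have h3 : 0 ≤ g (y + 1) - g y := sub_nonneg.2 (hg (by omega))
      rw [norm_mul, Complex.norm_real, Real.norm_of_nonneg h3]
      have h4 := mul_le_mul_of_nonneg_left (hc y (by omega)) h3
      linarith
  have h0 : 0 ≤ g Y := hg0.trans (hg (Nat.zero_le _))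
  have h1 := key Y le_rfl
  have h2 : ‖(g Y : ℂ) * ∑ l ∈ Finset.Icc 1 Y, c l‖ ≤ g Y * B := by
    rw [norm_mul, Complex.norm_real, Real.norm_of_nonneg h0]
    exact mul_le_mul_of_nonneg_left (hc Y le_rfl) h0
  have h3 := norm_add_le (∑ l ∈ Finset.Icc 1 Y, (g l : ℂ) * c l -
      g Y * ∑ l ∈ Finset.Icc 1 Y, c l) ((g Y : ℂ) * ∑ l ∈ Finset.Icc 1 Y, c l)
  rw [sub_add_cancel] at h3
  linarith

/-- Since f is a unit modulo d, one solution of ma ≡ f makes m a unit as well. The solutions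
therefore form one residue class or none. -/
theorem modEq_residue_of_coprime {f d m : ℕ} (hf : Nat.Coprime f d) {a b : ℕ}
    (ha : m * a ≡ f [MOD d]) : m * b ≡ f [MOD d] ↔ a ≡ b [MOD d] := by
  have hcop : Nat.Coprime d m := by
    have h1 : Nat.gcd (m * a) d = 1 := by
      rw [Nat.ModEq.gcd_eq ha]; exact hf
    exact (Nat.Coprime.coprime_mul_right h1).symm
  constructor
  · intro hb
    exact Nat.ModEq.cancel_left_of_coprime hcop (ha.trans hb.symm)
  · intro hab
    exact (hab.symm.mul_left m).trans ha

namespace ExpSumData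

variable {θ : ℝ} {N f d a q H : ℕ} {T : ℝ}

theorem norm_sum_apPhase_le (D : ExpSumData θ N f d a q H T) {k m : ℕ} (hk : 0 < k) (hm : 0 < m)
    (y : ℕ) (hy : y ≤ N / m) :
    ‖∑ l ∈ Finset.Icc 1 y, apPhase f d (θ * k) (m * l)‖ ≤
      min ((N : ℝ) / (m * d) + 1) (1 / distNearestInt (θ * (k * (d * m) : ℕ))) := by
  have h := norm_sum_expi_residue_le (θ * k * m) d y D.d_pos (fun l => m * l ≡ f [MOD d])
    (fun _ _ ha => modEq_residue_of_coprime D.coprime_f ha)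
  have h1 : ∀ l : ℕ, apPhase f d (θ * k) (m * l) =
      if m * l ≡ f [MOD d] then expi (θ * k * m * l) else 0 := by
    intro l; unfold apPhase; congr 2; push_cast; ring
  have h2 : θ * k * m * d = θ * (k * (d * m) : ℕ) := by push_cast; ring
  simp only [h1]
  rw [h2] at h
  refine le_min (h.1.trans ?_) (h.2 (D.dist_pos (Nat.mul_pos hk (Nat.mul_pos D.d_pos hm))))
  have hm' : (0 : ℝ) < m := by exact_mod_cast hm
  rw [← div_div]
  gcongr
  exact (Nat.cast_le.2 hy).trans Nat.cast_div_le

/-- Type I sums. -/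
theorem typeI (D : ExpSumData θ N f d a q H T) (M : ℕ) (hM : 0 < M) (hMN : M ≤ N) (c : ℕ → ℂ)
    (A : ℝ) (hc : ∀ m ∈ Finset.Icc 1 M, ‖c m‖ ≤ A) (g : ℕ → ℝ) (hg : Monotone g)
    (hg0 : 0 ≤ g 0) (G : ℝ) (hG : g N ≤ G) :
    ∑ k ∈ Finset.Icc 1 H, ‖∑ m ∈ Finset.Icc 1 M, ∑ l ∈ Finset.Icc 1 (N / m),
      c m * g l * apPhase f d (θ * k) (m * l)‖ ≤
      64 * A * G * T ^ 3 * (H * N / q + H * (d * M) + q) := by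
  have hT := D.one_le_T
  have hA : 0 ≤ A := (norm_nonneg _).trans (hc 1 (Finset.mem_Icc.2 ⟨le_rfl, hM⟩))
  have hG0 : 0 ≤ G := hg0.trans ((hg (Nat.zero_le N)).trans hG)
  have hq : (0 : ℝ) < q := by exact_mod_cast D.q_pos
  have hd : (0 : ℝ) < d := by exact_mod_cast D.d_pos
  have hH : (0 : ℝ) < H := by exact_mod_cast D.H_pos
  have hstep1 : ∀ k ∈ Finset.Icc 1 H, ‖∑ m ∈ Finset.Icc 1 M, ∑ l ∈ Finset.Icc 1 (N / m),
      c m * g l * apPhase f d (θ * k) (m * l)‖ ≤ ∑ m ∈ Finset.Icc 1 M, 2 * A * G *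
        min ((N : ℝ) / (m * d) + 1) (1 / distNearestInt (θ * (k * (d * m) : ℕ))) := by
    intro k hk
    refine (norm_sum_le _ _).trans (Finset.sum_le_sum fun m hm => ?_)
    have hk0 : 0 < k := (Finset.mem_Icc.1 hk).1
    have hm0 : 0 < m := (Finset.mem_Icc.1 hm).1
    simp only [mul_assoc (c m)]
    rw [← Finset.mul_sum, norm_mul]
    have hpos : 0 ≤ min ((N : ℝ) / (m * d) + 1)
        (1 / distNearestInt (θ * (k * (d * m) : ℕ))) :=
      le_min (by positivity) (one_div_nonneg.2 (distNearestInt_nonneg _))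
    have h1 := norm_sum_monotone_mul_le g hg hg0 (fun l => apPhase f d (θ * k) (m * l)) _ hpos
      (N / m) (fun y hy => D.norm_sum_apPhase_le hk0 hm0 y hy)
    have h2 : g (N / m) ≤ G := (hg (Nat.div_le_self N m)).trans hG
    calc _ ≤ A * (2 * g (N / m) * _) := mul_le_mul (hc m hm) h1 (norm_nonneg _) hA
      _ ≤ A * (2 * G * min ((N : ℝ) / (m * d) + 1)
            (1 / distNearestInt (θ * (k * (d * m) : ℕ)))) := by gcongr
      _ = _ := by ring
  refine (Finset.sum_le_sum hstep1).trans ?_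
  simp only [← Finset.mul_sum]
  -- Dyadic decomposition in m: on each block N/(md) + 1 is at most a constant Z, as the estimate
  -- for sums of min(Z, 1/‖θkdy‖) requires.
  have hmaps : ∀ m ∈ Finset.Icc 1 M, Nat.log 2 m ∈ Finset.range (Nat.log 2 N + 1) := by
    intro m hm
    rw [Finset.mem_range, Nat.lt_succ_iff]
    exact Nat.log_mono_right ((Finset.mem_Icc.1 hm).2.trans hMN)
  have hdy : ∀ i ∈ Finset.range (Nat.log 2 N + 1), ∑ k ∈ Finset.Icc 1 H,
      ∑ m ∈ (Finset.Icc 1 M).filter (fun m => Nat.log 2 m = i), min ((N : ℝ) / (m * d) + 1)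
        (1 / distNearestInt (θ * (k * (d * m) : ℕ))) ≤
      32 * T ^ 2 * (H * N / q + H * (d * M) + q) := by
    intro i _
    by_cases hiM : 2 ^ i ≤ M
    swap
    · rw [Finset.filter_false_of_mem]
      · simp only [Finset.sum_empty, Finset.sum_const_zero]; positivity
      · intro m hm h
        rw [Finset.mem_Icc] at hm
        have := Nat.pow_log_le_self 2 (show m ≠ 0 by omega)
        rw [h] at this
        omega
    have hiM' : (2 : ℝ) ^ i ≤ M := by exact_mod_cast hiM
    set Z : ℝ := (N : ℝ) / (2 ^ i * d) + 1 with hZ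
    have hZ0 : 0 ≤ Z := by positivity
    have h1 : ∑ k ∈ Finset.Icc 1 H,
      ∑ m ∈ (Finset.Icc 1 M).filter (fun m => Nat.log 2 m = i), min ((N : ℝ) / (m * d) + 1)
        (1 / distNearestInt (θ * (k * (d * m) : ℕ))) ≤ ∑ k ∈ Finset.Icc 1 H,
      ∑ m ∈ Finset.Icc 1 (2 ^ (i + 1)), min Z
        (1 / distNearestInt (θ * (k * (d * m) : ℕ))) := by
      refine Finset.sum_le_sum fun k _ => ?_
      refine (Finset.sum_le_sum (g := fun m : ℕ =>
        min Z (1 / distNearestInt (θ * (k * (d * m) : ℕ)))) ?_).trans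
        (Finset.sum_le_sum_of_subset_of_nonneg ?_ ?_)
      · intro m hm
        rw [Finset.mem_filter, Finset.mem_Icc] at hm
        refine min_le_min_right _ ?_
        have h2 := Nat.pow_log_le_self 2 (show m ≠ 0 by omega)
        rw [hm.2] at h2
        have h3 : (2 : ℝ) ^ i ≤ m := by exact_mod_cast h2
        rw [hZ]
        gcongr
      · intro m hm
        rw [Finset.mem_filter, Finset.mem_Icc] at hm
        have h2 := Nat.lt_pow_succ_log_self (b := 2) (by norm_num) m
        rw [hm.2] at h2
        rw [Finset.mem_Icc]
        exact ⟨hm.1.1, h2.le⟩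
      · intro m _ _
        exact le_min hZ0 (one_div_nonneg.2 (distNearestInt_nonneg _))
    refine h1.trans ((D.sum_sum_min_le (2 ^ (i + 1)) ?_ Z hZ0).trans ?_)
    · calc 2 ^ (i + 1) = 2 * 2 ^ i := by ring
        _ ≤ N * N := Nat.mul_le_mul D.two_le_N (hiM.trans hMN)
        _ = N ^ 2 := by ring
    · have h2 : (H : ℝ) * (d * (2 ^ (i + 1) : ℕ)) * Z / q =
          2 * (H * N / q) + 2 * (H * (d * 2 ^ i) / q) := by
        rw [hZ]; push_cast; field_simp; ring
      have h3 : (H : ℝ) * (d * (2 ^ (i + 1) : ℕ)) = 2 * (H * (d * 2 ^ i)) := by push_cast; ring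
      have h4 : (H : ℝ) * (d * 2 ^ i) ≤ H * (d * M) := by gcongr
      have h5 : (H : ℝ) * (d * 2 ^ i) / q ≤ H * (d * M) := by
        refine (div_le_self (by positivity) ?_).trans h4
        exact_mod_cast D.q_pos
      rw [h2, h3]
      have h6 : 2 * (H * N / q : ℝ) + 2 * (H * (d * 2 ^ i) / q) + 2 * (H * (d * 2 ^ i)) + q ≤
          4 * (H * N / q + H * (d * M) + q) := by
        have : (0 : ℝ) ≤ H * N / q := by positivity
        linarith
      calc _ ≤ 8 * T ^ 2 * (4 * (H * N / q + H * (d * M) + q)) := by gcongr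
        _ = _ := by ring
  have hswap : ∑ k ∈ Finset.Icc 1 H, ∑ m ∈ Finset.Icc 1 M, min ((N : ℝ) / (m * d) + 1)
        (1 / distNearestInt (θ * (k * (d * m) : ℕ))) =
      ∑ i ∈ Finset.range (Nat.log 2 N + 1), ∑ k ∈ Finset.Icc 1 H,
      ∑ m ∈ (Finset.Icc 1 M).filter (fun m => Nat.log 2 m = i), min ((N : ℝ) / (m * d) + 1)
        (1 / distNearestInt (θ * (k * (d * m) : ℕ))) := by
    rw [Finset.sum_comm (s := Finset.range (Nat.log 2 N + 1))]
    exact Finset.sum_congr rfl fun k _ => (Finset.sum_fiberwise_of_maps_to hmaps _).symm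
  rw [hswap]
  have h7 := Finset.sum_le_card_nsmul _ _ _ hdy
  rw [Finset.card_range, nsmul_eq_mul] at h7
  have h8 : ((Nat.log 2 N + 1 : ℕ) : ℝ) ≤ T := by
    push_cast; exact D.natLog_le
  calc _ ≤ 2 * A * G * (((Nat.log 2 N + 1 : ℕ) : ℝ) *
        (32 * T ^ 2 * (H * N / q + H * (d * M) + q))) := by gcongr
    _ ≤ 2 * A * G * (T * (32 * T ^ 2 * (H * N / q + H * (d * M) + q))) := by gcongr
    _ = _ := by ring

end ExpSumData

/-! ### Type II sums -/

/-- The argument `(l - l') + (l' - l)` is |l - l'| in truncated subtraction. For fixed l each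
nonzero value occurs at most twice, once on either side. -/
theorem sum_dist_le (f : ℕ → ℝ) (hf : ∀ y, 0 ≤ f y) (Z : ℝ) (L l : ℕ)
    (hl : l ∈ Finset.Ico L (2 * L)) :
    ∑ l' ∈ Finset.Ico L (2 * L), (if l = l' then Z else f ((l - l') + (l' - l))) ≤
      Z + 2 * ∑ y ∈ Finset.Icc 1 L, f y := by
  have key : ∀ s : Finset ℕ, ∀ v : ℕ → ℕ, Set.InjOn v s → (∀ x ∈ s, v x ∈ Finset.Icc 1 L) →
      ∑ x ∈ s, f (v x) ≤ ∑ y ∈ Finset.Icc 1 L, f y := by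
    intro s v hinj hmem
    rw [← Finset.sum_image hinj (f := f)]
    exact Finset.sum_le_sum_of_subset_of_nonneg (Finset.image_subset_iff.2 hmem) fun y _ _ => hf y
  rw [← Finset.add_sum_erase _ _ hl, if_pos rfl]
  rw [Finset.mem_Ico] at hl
  rw [← Finset.sum_filter_add_sum_filter_not ((Finset.Ico L (2 * L)).erase l) (fun l' => l' < l)]
  have h1 : ∑ l' ∈ ((Finset.Ico L (2 * L)).erase l).filter (fun l' => l' < l),
      (if l = l' then Z else f ((l - l') + (l' - l))) ≤ ∑ y ∈ Finset.Icc 1 L, f y := by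
    refine le_trans (le_of_eq (Finset.sum_congr rfl fun l' hl' => ?_))
      (key (((Finset.Ico L (2 * L)).erase l).filter (fun l' => l' < l))
        (fun l' => (l - l') + (l' - l)) ?_ ?_)
    · rw [if_neg (by have := (Finset.mem_filter.1 hl').2; omega)]
    · intro x hx y hy hxy
      simp only [Finset.coe_filter, Set.mem_ofPred_eq] at hx hy hxy
      omega
    · intro x hx
      simp only [Finset.mem_filter, Finset.mem_erase, Finset.mem_Ico, Finset.mem_Icc] at hx ⊢
      omega
  have h2 : ∑ l' ∈ ((Finset.Ico L (2 * L)).erase l).filter (fun l' => ¬ l' < l),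
      (if l = l' then Z else f ((l - l') + (l' - l))) ≤ ∑ y ∈ Finset.Icc 1 L, f y := by
    refine le_trans (le_of_eq (Finset.sum_congr rfl fun l' hl' => ?_))
      (key (((Finset.Ico L (2 * L)).erase l).filter (fun l' => ¬ l' < l))
        (fun l' => (l - l') + (l' - l)) ?_ ?_)
    · rw [if_neg]
      simp only [Finset.mem_filter, Finset.mem_erase] at hl'
      omega
    · intro x hx y hy hxy
      simp only [Finset.coe_filter, Set.mem_ofPred_eq] at hx hy hxy
      omega
    · intro x hx
      simp only [Finset.mem_filter, Finset.mem_erase, Finset.mem_Ico, Finset.mem_Icc] at hx ⊢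
      omega
  linarith

/-- Expanding the square of a linear form and exchanging summations. -/
theorem sum_norm_sq_le (s t : Finset ℕ) (b : ℕ → ℂ) (B : ℝ) (hb : ∀ l ∈ t, ‖b l‖ ≤ B)
    (u : ℕ → ℕ → ℂ) :
    ∑ m ∈ s, ‖∑ l ∈ t, b l * u l m‖ ^ 2 ≤
      B ^ 2 * ∑ l ∈ t, ∑ l' ∈ t, ‖∑ m ∈ s, u l m * (starRingEnd ℂ) (u l' m)‖ := by
  have h1 : ((∑ m ∈ s, ‖∑ l ∈ t, b l * u l m‖ ^ 2 : ℝ) : ℂ) =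
      ∑ l ∈ t, ∑ l' ∈ t, b l * (starRingEnd ℂ) (b l') *
        ∑ m ∈ s, u l m * (starRingEnd ℂ) (u l' m) := by
    push_cast
    simp only [← Complex.mul_conj', map_sum, Finset.sum_mul_sum, map_mul]
    rw [Finset.sum_comm]
    refine Finset.sum_congr rfl fun l _ => ?_
    rw [Finset.sum_comm]
    refine Finset.sum_congr rfl fun l' _ => ?_
    rw [Finset.mul_sum]
    refine Finset.sum_congr rfl fun m _ => ?_
    ring
  have h2 : 0 ≤ ∑ m ∈ s, ‖∑ l ∈ t, b l * u l m‖ ^ 2 := by positivity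
  have h3 := congrArg norm h1
  rw [Complex.norm_real, Real.norm_of_nonneg h2] at h3
  rw [h3, Finset.mul_sum]
  refine (norm_sum_le _ _).trans (Finset.sum_le_sum fun l hl => ?_)
  rw [Finset.mul_sum]
  refine (norm_sum_le _ _).trans (Finset.sum_le_sum fun l' hl' => ?_)
  rw [norm_mul, norm_mul, RCLike.norm_conj, sq]
  have := hb l hl
  have := hb l' hl'
  gcongr
  exact (norm_nonneg _).trans (hb l hl)

namespace ExpSumData

variable {θ : ℝ} {N f d a q H : ℕ} {T : ℝ}

/-- The product of the phases has frequency θk(l - l'). The two truncations combine to m ≤ min(N/l,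
N/l'), and the two congruences cut out a single class modulo d or nothing, so the saving 1/d
persists on the diagonal. -/
theorem norm_sum_apPhase_mul_conj_le (D : ExpSumData θ N f d a q H T) {k L l l' : ℕ} (hk : 0 < k)
    (hL : 0 < L) (hl : L ≤ l) (hl' : L ≤ l') :
    ‖∑ m ∈ Finset.Icc 1 (N / L), (if l * m ≤ N then apPhase f d (θ * k) (l * m) else 0) *
      (starRingEnd ℂ) (if l' * m ≤ N then apPhase f d (θ * k) (l' * m) else 0)‖ ≤
      if l = l' then (N : ℝ) / (L * d) + 1 else min ((N : ℝ) / (L * d) + 1)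
        (1 / distNearestInt (θ * (k * (d * ((l - l') + (l' - l))) : ℕ))) := by
  set Y := min (N / l) (N / l') with hY
  have hYL : Y ≤ N / L := (min_le_left _ _).trans (Nat.div_le_div_left hl hL)
  have hmem : ∀ m, (l * m ≤ N ∧ l' * m ≤ N) ↔ m ≤ Y := by
    intro m
    rw [hY, le_min_iff, Nat.le_div_iff_mul_le (by omega), Nat.le_div_iff_mul_le (by omega),
      mul_comm m, mul_comm m]
  have hterm : ∀ m : ℕ, (if l * m ≤ N then apPhase f d (θ * k) (l * m) else 0) *
      (starRingEnd ℂ) (if l' * m ≤ N then apPhase f d (θ * k) (l' * m) else 0) =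
      if m ≤ Y then (if l * m ≡ f [MOD d] ∧ l' * m ≡ f [MOD d] then
        expi (θ * k * ((l : ℝ) - l') * m) else 0) else 0 := by
    intro m
    rw [← if_congr (hmem m) rfl rfl]
    unfold apPhase
    by_cases h1 : l * m ≤ N <;> by_cases h2 : l' * m ≤ N <;>
      by_cases h3 : l * m ≡ f [MOD d] <;> by_cases h4 : l' * m ≡ f [MOD d] <;>
      simp [h1, h2, h3, h4]
    rw [conj_expi, ← expi_add]
    congr 1; ring
  simp only [hterm]
  rw [← Finset.sum_filter]
  have hset : (Finset.Icc 1 (N / L)).filter (fun m => m ≤ Y) = Finset.Icc 1 Y := by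
    ext m; simp only [Finset.mem_filter, Finset.mem_Icc]; omega
  rw [hset]
  have h := norm_sum_expi_residue_le (θ * k * ((l : ℝ) - l')) d Y D.d_pos
    (fun m => l * m ≡ f [MOD d] ∧ l' * m ≡ f [MOD d]) (by
      intro x y hx
      rw [modEq_residue_of_coprime D.coprime_f hx.1, modEq_residue_of_coprime D.coprime_f hx.2,
        and_self])
  have hZ : (Y : ℝ) / d + 1 ≤ (N : ℝ) / (L * d) + 1 := by
    rw [← div_div]
    gcongr
    exact (Nat.cast_le.2 hYL).trans Nat.cast_div_le
  split_ifs with hll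
  · exact h.1.trans hZ
  · have h5 : distNearestInt (θ * k * ((l : ℝ) - l') * d) =
        distNearestInt (θ * (k * (d * ((l - l') + (l' - l))) : ℕ)) := by
      rcases lt_or_gt_of_ne hll with h6 | h6
      · rw [← distNearestInt_neg]
        congr 1
        rw [Nat.sub_eq_zero_of_le h6.le, zero_add]
        push_cast [Nat.cast_sub h6.le]
        ring
      · congr 1
        rw [Nat.sub_eq_zero_of_le h6.le, add_zero]
        push_cast [Nat.cast_sub h6.le]
        ring
    rw [h5] at h
    exact le_min (h.1.trans hZ) (h.2 (D.dist_pos (Nat.mul_pos hk (Nat.mul_pos D.d_pos (by omega)))))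

/-- Type II sums. -/
theorem typeII (D : ExpSumData θ N f d a q H T) (L : ℕ) (hL : 0 < L) (hLN : L ≤ N)
    (u v : ℕ → ℂ) (A B : ℝ)
    (hu : ∀ m ∈ Finset.Icc 1 N, ‖u m‖ ≤ A)
    (hv : ∀ l ∈ Finset.Ico L (2 * L), ‖v l‖ ≤ B) :
    (∑ k ∈ Finset.Icc 1 H, ‖∑ l ∈ Finset.Ico L (2 * L), ∑ m ∈ Finset.Icc 1 (N / l),
      v l * u m * apPhase f d (θ * k) (l * m)‖) ^ 2 ≤
      33 * (A * B * T * H) ^ 2 * (N * (N / (L * d) + N / q + d * L + q)) := by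
  have hT := D.one_le_T
  have hA : 0 ≤ A := (norm_nonneg _).trans (hu 1 (Finset.mem_Icc.2 (by omega)))
  have hq : (0 : ℝ) < q := by exact_mod_cast D.q_pos
  have hq1 : (1 : ℝ) ≤ q := by exact_mod_cast D.q_pos
  have hd1 : (1 : ℝ) ≤ d := by exact_mod_cast D.d_pos
  have hH1 : (1 : ℝ) ≤ H := by exact_mod_cast D.H_pos
  have hL1 : (1 : ℝ) ≤ L := by exact_mod_cast hL
  have hB : 0 ≤ B := (norm_nonneg _).trans (hv L (Finset.mem_Ico.2 (by omega)))
  -- The condition lm ≤ N is moved into the phase, so that the range of m no longer depends on l and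
  -- the sums can be exchanged.
  let w : ℕ → ℕ → ℕ → ℂ := fun k l m => if l * m ≤ N then apPhase f d (θ * k) (l * m) else 0
  let X : ℕ → ℕ → ℂ := fun k m => ∑ l ∈ Finset.Ico L (2 * L), v l * w k l m
  set Z : ℝ := (N : ℝ) / (L * d) + 1 with hZ
  have hZ0 : 0 ≤ Z := by positivity
  have hswap : ∀ k : ℕ, ∑ l ∈ Finset.Ico L (2 * L), ∑ m ∈ Finset.Icc 1 (N / l),
      v l * u m * apPhase f d (θ * k) (l * m) = ∑ m ∈ Finset.Icc 1 (N / L), u m * X k m := by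
    intro k
    simp only [X, Finset.mul_sum]
    rw [Finset.sum_comm (s := Finset.Icc 1 (N / L))]
    refine Finset.sum_congr rfl fun l hl => ?_
    rw [Finset.mem_Ico] at hl
    have hset : Finset.Icc 1 (N / l) = (Finset.Icc 1 (N / L)).filter (fun m => l * m ≤ N) := by
      ext m
      have h1 : m ≤ N / l ↔ l * m ≤ N := by
        rw [Nat.le_div_iff_mul_le (by omega), mul_comm]
      have h2 : N / l ≤ N / L := Nat.div_le_div_left hl.1 hL
      simp only [Finset.mem_filter, Finset.mem_Icc, ← h1]
      omega
    rw [hset, Finset.sum_filter]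
    refine Finset.sum_congr rfl fun m _ => ?_
    simp only [w]
    split_ifs <;> ring
  have hsq : ∀ k ∈ Finset.Icc 1 H, ∑ m ∈ Finset.Icc 1 (N / L), ‖X k m‖ ^ 2 ≤
      B ^ 2 * (L * (Z + 2 * ∑ y ∈ Finset.Icc 1 L,
        min Z (1 / distNearestInt (θ * (k * (d * y) : ℕ))))) := by
    intro k hk
    refine (sum_norm_sq_le _ _ v B hv (w k)).trans ?_
    gcongr
    have h1 : ∀ l ∈ Finset.Ico L (2 * L), ∑ l' ∈ Finset.Ico L (2 * L),
        ‖∑ m ∈ Finset.Icc 1 (N / L), w k l m * (starRingEnd ℂ) (w k l' m)‖ ≤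
        Z + 2 * ∑ y ∈ Finset.Icc 1 L,
          min Z (1 / distNearestInt (θ * (k * (d * y) : ℕ))) := by
      intro l hl
      refine le_trans (Finset.sum_le_sum fun l' hl' => ?_)
        (sum_dist_le (fun y => min Z (1 / distNearestInt (θ * (k * (d * y) : ℕ))))
          (fun y => le_min hZ0 (one_div_nonneg.2 (distNearestInt_nonneg _))) Z L l hl)
      exact D.norm_sum_apPhase_mul_conj_le (Finset.mem_Icc.1 hk).1 hL (Finset.mem_Ico.1 hl).1
        (Finset.mem_Ico.1 hl').1
    refine (Finset.sum_le_card_nsmul _ _ _ h1).trans_eq ?_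
    rw [Nat.card_Ico, nsmul_eq_mul]
    congr 2
    omega
  have hR := D.sum_sum_min_le L (hLN.trans (by nlinarith [D.two_le_N])) Z hZ0
  -- Cauchy–Schwarz is applied to k and m jointly, which keeps the average over frequencies for the
  -- off-diagonal terms.
  have hcauchy : (∑ k ∈ Finset.Icc 1 H, ∑ m ∈ Finset.Icc 1 (N / L), ‖X k m‖) ^ 2 ≤
      (H * (N / L : ℕ)) * ∑ k ∈ Finset.Icc 1 H, ∑ m ∈ Finset.Icc 1 (N / L), ‖X k m‖ ^ 2 := by
    rw [← Finset.sum_product', ← Finset.sum_product']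
    refine sq_sum_le_card_mul_sum_sq.trans_eq ?_
    rw [Finset.card_product, Nat.card_Icc, Nat.card_Icc]
    simp
  have htri : ∑ k ∈ Finset.Icc 1 H, ‖∑ l ∈ Finset.Ico L (2 * L), ∑ m ∈ Finset.Icc 1 (N / l),
      v l * u m * apPhase f d (θ * k) (l * m)‖ ≤
      A * ∑ k ∈ Finset.Icc 1 H, ∑ m ∈ Finset.Icc 1 (N / L), ‖X k m‖ := by
    rw [Finset.mul_sum]
    refine Finset.sum_le_sum fun k _ => ?_
    rw [hswap, Finset.mul_sum]
    refine (norm_sum_le _ _).trans (Finset.sum_le_sum fun m hm => ?_)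
    rw [norm_mul]
    refine mul_le_mul_of_nonneg_right (hu m ?_) (norm_nonneg _)
    exact Finset.Icc_subset_Icc_right (Nat.div_le_self N L) hm
  have hsum : ∑ k ∈ Finset.Icc 1 H, ∑ m ∈ Finset.Icc 1 (N / L), ‖X k m‖ ^ 2 ≤
      B ^ 2 * (L * (H * Z + 2 * (8 * T ^ 2 * (H * (d * L) * Z / q + H * (d * L) + q)))) := by
    refine (Finset.sum_le_sum hsq).trans ?_
    rw [← Finset.mul_sum, ← Finset.mul_sum, Finset.sum_add_distrib, ← Finset.mul_sum,
      Finset.sum_const, Nat.card_Icc, nsmul_eq_mul, Nat.add_sub_cancel]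
    gcongr
  have hNL : ((N / L : ℕ) : ℝ) * L ≤ N := by exact_mod_cast Nat.div_mul_le_self N L
  set E : ℝ := N / (L * d) + N / q + d * L + q with hE
  -- The constant is 33 = 1 + 2·8·2: the diagonal gives at most T²HE, and the bracket of
  -- off-diagonal terms is at most 2HE.
  have hfin : H * Z + 2 * (8 * T ^ 2 * (H * (d * L) * Z / q + H * (d * L) + q)) ≤
      33 * T ^ 2 * H * E := by
    have h1 : (H : ℝ) * (d * L) * Z / q = H * (N / q) + H * (d * L) / q := by
      rw [hZ]; field_simp
    have h2 : (H : ℝ) * (d * L) / q ≤ H * (d * L) := div_le_self (by positivity) hq1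
    have h3 : (q : ℝ) ≤ H * q := by nlinarith
    have h4 : H * Z ≤ T ^ 2 * (H * E) := by
      have h5 : Z ≤ E := by
        have : (1 : ℝ) ≤ q := hq1
        have : (0 : ℝ) ≤ N / q := by positivity
        have : (0 : ℝ) ≤ d * L := by positivity
        rw [hZ, hE]; linarith
      have h6 : H * Z ≤ H * E := by gcongr
      have h7 : 0 ≤ H * E := by positivity
      nlinarith [one_le_pow₀ hT (n := 2)]
    have h8 : H * (d * L) * Z / q + H * (d * L) + q ≤ 2 * (H * E) := by
      have : (0 : ℝ) ≤ H * (N / (L * d)) := by positivity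
      have : (0 : ℝ) ≤ H * (N / q) := by positivity
      have h9 : H * E = H * (N / (L * d)) + H * (N / q) + H * (d * L) + H * q := by
        rw [hE]; ring
      rw [h1, h9]; linarith
    have h10 : T ^ 2 * (H * (d * L) * Z / q + H * (d * L) + q) ≤ T ^ 2 * (2 * (H * E)) := by gcongr
    nlinarith
  calc _ ≤ (A * ∑ k ∈ Finset.Icc 1 H, ∑ m ∈ Finset.Icc 1 (N / L), ‖X k m‖) ^ 2 := by gcongr
    _ = A ^ 2 * (∑ k ∈ Finset.Icc 1 H, ∑ m ∈ Finset.Icc 1 (N / L), ‖X k m‖) ^ 2 := by ring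
    _ ≤ A ^ 2 * ((H * (N / L : ℕ)) * (B ^ 2 * (L * (33 * T ^ 2 * H * E)))) := by
        gcongr
        refine hcauchy.trans ?_
        gcongr
        refine hsum.trans ?_
        gcongr
    _ = 33 * (A * B * T * H) ^ 2 * ((((N / L : ℕ) : ℝ) * L) * E) := by ring
    _ ≤ _ := by gcongr

end ExpSumData

/-! ### Vaughan's identity and its consequences -/

open ArithmeticFunction in
/-- The restriction of an arithmetic function to arguments at most `U`. -/
noncomputable def lowPart (U : ℕ) (F : ArithmeticFunction ℝ) : ArithmeticFunction ℝ :=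
  ⟨fun n => if n ≤ U then F n else 0, by simp⟩

theorem lowPart_apply (U : ℕ) (F : ArithmeticFunction ℝ) (n : ℕ) :
    lowPart U F n = if n ≤ U then F n else 0 := rfl

theorem sub_lowPart_apply (U : ℕ) (F : ArithmeticFunction ℝ) (n : ℕ) :
    (F - lowPart U F) n = if n ≤ U then 0 else F n := by
  have h : (F - lowPart U F) n + lowPart U F n = F n := by
    rw [← ArithmeticFunction.add_apply, sub_add_cancel]
  rw [lowPart_apply] at h
  split_ifs at h ⊢ <;> linarith

theorem sum_arith_mul (F G : ArithmeticFunction ℝ) (h : ℕ → ℂ) (N : ℕ) :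
    ∑ n ∈ Finset.Icc 1 N, ((F * G) n : ℂ) * h n =
      ∑ m ∈ Finset.Icc 1 N, ∑ l ∈ Finset.Icc 1 (N / m), (F m : ℂ) * G l * h (m * l) := by
  have h1 : ∀ m ∈ Finset.Icc 1 N, ∑ l ∈ Finset.Icc 1 (N / m), (F m : ℂ) * G l * h (m * l) =
      ∑ l ∈ Finset.Icc 1 N, if m * l ≤ N then (F m : ℂ) * G l * h (m * l) else 0 := by
    intro m hm
    rw [Finset.mem_Icc] at hm
    rw [← Finset.sum_filter]
    congr 1
    ext l
    have h2 : l ≤ N / m ↔ m * l ≤ N := by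
      rw [Nat.le_div_iff_mul_le (by omega), mul_comm]
    have h3 : N / m ≤ N := Nat.div_le_self N m
    simp only [Finset.mem_filter, Finset.mem_Icc, ← h2]
    omega
  rw [Finset.sum_congr rfl h1, ← Finset.sum_product', ← Finset.sum_filter]
  have hmaps : ∀ z ∈ (Finset.Icc 1 N ×ˢ Finset.Icc 1 N).filter (fun z => z.1 * z.2 ≤ N),
      z.1 * z.2 ∈ Finset.Icc 1 N := by
    rintro ⟨m, l⟩ hz
    simp only [Finset.mem_filter, Finset.mem_product, Finset.mem_Icc] at hz ⊢
    exact ⟨Nat.mul_pos hz.1.1.1 hz.1.2.1, hz.2⟩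
  rw [← Finset.sum_fiberwise_of_maps_to hmaps]
  refine Finset.sum_congr rfl fun n hn => ?_
  rw [Finset.mem_Icc] at hn
  rw [ArithmeticFunction.mul_apply]
  push_cast
  rw [Finset.sum_mul]
  have hset : n.divisorsAntidiagonal =
      ((Finset.Icc 1 N ×ˢ Finset.Icc 1 N).filter (fun z => z.1 * z.2 ≤ N)).filter
        (fun z => z.1 * z.2 = n) := by
    ext ⟨m, l⟩
    simp only [Nat.mem_divisorsAntidiagonal, Finset.mem_filter, Finset.mem_product, Finset.mem_Icc]
    constructor
    · rintro ⟨rfl, h0⟩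
      have hm : m ≠ 0 := left_ne_zero_of_mul h0
      have hl : l ≠ 0 := right_ne_zero_of_mul h0
      have h4 : m ≤ m * l := Nat.le_mul_of_pos_right m (by omega)
      have h5 : l ≤ m * l := Nat.le_mul_of_pos_left l (by omega)
      refine ⟨⟨⟨⟨by omega, by omega⟩, by omega, by omega⟩, hn.2⟩, rfl⟩
    · rintro ⟨_, rfl⟩
      exact ⟨rfl, by omega⟩
  rw [hset]
  refine Finset.sum_congr rfl fun z hz => ?_
  rw [(Finset.mem_filter.1 hz).2]

open ArithmeticFunction in
/-- Vaughan's identity. -/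
theorem vaughan_identity (U : ℕ) :
    vonMangoldt = lowPart U vonMangoldt +
      lowPart U ((moebius : ArithmeticFunction ℤ) : ArithmeticFunction ℝ) * log -
      lowPart U ((moebius : ArithmeticFunction ℤ) : ArithmeticFunction ℝ) *
        lowPart U vonMangoldt * ((zeta : ArithmeticFunction ℕ) : ArithmeticFunction ℝ) +
      (vonMangoldt - lowPart U vonMangoldt) *
        (((zeta : ArithmeticFunction ℕ) : ArithmeticFunction ℝ) *
          (((moebius : ArithmeticFunction ℤ) : ArithmeticFunction ℝ) -
            lowPart U ((moebius : ArithmeticFunction ℤ) : ArithmeticFunction ℝ))) := by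
  have h1 : vonMangoldt * ((zeta : ArithmeticFunction ℕ) : ArithmeticFunction ℝ) = log :=
    vonMangoldt_mul_zeta
  have h2 : ((moebius : ArithmeticFunction ℤ) : ArithmeticFunction ℝ) *
    ((zeta : ArithmeticFunction ℕ) : ArithmeticFunction ℝ) = 1 := coe_moebius_mul_coe_zeta
  linear_combination (lowPart U ((moebius : ArithmeticFunction ℤ) : ArithmeticFunction ℝ)) * h1 -
    (vonMangoldt - lowPart U vonMangoldt) * h2

theorem abs_moebius_cast_le (n : ℕ) :
    |((ArithmeticFunction.moebius : ArithmeticFunction ℤ) : ArithmeticFunction ℝ) n| ≤ 1 := by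
  rw [ArithmeticFunction.intCoe_apply]
  exact_mod_cast ArithmeticFunction.abs_moebius_le_one

namespace ExpSumData

variable {θ : ℝ} {N f d a q H : ℕ} {T : ℝ}

theorem log_natCast_le (D : ExpSumData θ N f d a q H T) {n : ℕ} (hn : n ≤ N) :
    Real.log n ≤ T := by
  have := D.log_le
  rcases Nat.eq_zero_or_pos n with rfl | h
  · simpa using D.one_le_T.trans' zero_le_one
  · have h1 : Real.log n ≤ Real.log N :=
      Real.log_le_log (by exact_mod_cast h) (by exact_mod_cast hn)
    linarith

theorem vonMangoldt_le (D : ExpSumData θ N f d a q H T) {n : ℕ} (hn : n ≤ N) :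
    ArithmeticFunction.vonMangoldt n ≤ T :=
  ArithmeticFunction.vonMangoldt_le_log.trans (D.log_natCast_le hn)

theorem card_divisors_le (D : ExpSumData θ N f d a q H T) {n : ℕ} (hn : n ∈ Finset.Icc 1 N) :
    (n.divisors.card : ℝ) ≤ T :=
  D.divisors_le n (Finset.Icc_subset_Icc_right
    (Nat.le_self_pow (by norm_num) N) hn)

/-- Bilinear sums with one variable in a dyadically decomposed range `(U, s]`. -/
theorem bilinear (D : ExpSumData θ N f d a q H T) (U s : ℕ) (hU : 0 < U)
    (u v : ℕ → ℂ) (hu : ∀ m ∈ Finset.Icc 1 N, ‖u m‖ ≤ T)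
    (hv : ∀ l ∈ Finset.Icc 1 N, ‖v l‖ ≤ T) (hv0 : ∀ l, v l ≠ 0 → U < l ∧ l ≤ s) :
    ∑ k ∈ Finset.Icc 1 H, ‖∑ l ∈ Finset.Icc 1 N, ∑ m ∈ Finset.Icc 1 (N / l),
      v l * u m * apPhase f d (θ * k) (l * m)‖ ≤
      9 * T ^ 4 * H * √(N * (N / (U * d) + N / q + d * s + q)) := by
  have hT := D.one_le_T
  have hU' : (0 : ℝ) < U := by exact_mod_cast hU
  have hd' : (0 : ℝ) < d := by exact_mod_cast D.d_pos
  set R : ℝ := √(N * (N / (U * d) + N / q + d * s + q)) with hR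
  have hR0 : 0 ≤ R := Real.sqrt_nonneg _
  have hR2 : R ^ 2 = N * (N / (U * d) + N / q + d * s + q) := Real.sq_sqrt (by positivity)
  have hmaps : ∀ l ∈ Finset.Icc 1 N, Nat.log 2 l ∈ Finset.range (Nat.log 2 N + 1) := by
    intro l hl
    rw [Finset.mem_range, Nat.lt_succ_iff]
    exact Nat.log_mono_right (Finset.mem_Icc.1 hl).2
  have hpiece : ∀ i ∈ Finset.range (Nat.log 2 N + 1), ∑ k ∈ Finset.Icc 1 H,
      ‖∑ l ∈ (Finset.Icc 1 N).filter (fun l => Nat.log 2 l = i), ∑ m ∈ Finset.Icc 1 (N / l),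
        v l * u m * apPhase f d (θ * k) (l * m)‖ ≤ 9 * T ^ 3 * H * R := by
    intro i hi
    have hiN : 2 ^ i ≤ N := by
      rw [Finset.mem_range, Nat.lt_succ_iff] at hi
      exact Nat.pow_le_of_le_log (by have := D.two_le_N; omega) hi
    have hmem : ∀ l, l ∈ Finset.Ico (2 ^ i) (2 * 2 ^ i) → 0 < l ∧ Nat.log 2 l = i := by
      intro l hl
      rw [Finset.mem_Ico] at hl
      have hpos : 0 < 2 ^ i := by positivity
      exact ⟨by omega, Nat.log_eq_of_pow_le_of_lt_pow hl.1 (by rw [pow_succ]; omega)⟩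
    -- A dyadic block that misses (U, s] contributes nothing; for the others 2^i lies between U/2
    -- and s.
    by_cases hex : 2 ^ i ≤ s ∧ U < 2 * 2 ^ i
    swap
    · have hz : ∀ k : ℕ, ∑ l ∈ (Finset.Icc 1 N).filter (fun l => Nat.log 2 l = i),
          ∑ m ∈ Finset.Icc 1 (N / l), v l * u m * apPhase f d (θ * k) (l * m) = 0 := by
        intro k
        refine Finset.sum_eq_zero fun l hl => Finset.sum_eq_zero fun m _ => ?_
        rw [Finset.mem_filter, Finset.mem_Icc] at hl
        by_cases hvl : v l = 0
        · simp [hvl]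
        exfalso
        apply hex
        have h1 := hv0 l hvl
        have h2 := Nat.pow_log_le_self 2 (show l ≠ 0 by omega)
        have h3 := Nat.lt_pow_succ_log_self (b := 2) (by norm_num) l
        rw [hl.2] at h2 h3
        rw [pow_succ] at h3
        omega
      simp only [hz, norm_zero, Finset.sum_const_zero]
      positivity
    -- The last dyadic block may reach beyond N, where no bound on v is available; there v is
    -- replaced by 0.
    let v' : ℕ → ℂ := fun l => if l ≤ N then v l else 0
    have heq : ∀ k : ℕ, ∑ l ∈ (Finset.Icc 1 N).filter (fun l => Nat.log 2 l = i),
        ∑ m ∈ Finset.Icc 1 (N / l), v l * u m * apPhase f d (θ * k) (l * m) =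
        ∑ l ∈ Finset.Ico (2 ^ i) (2 * 2 ^ i),
          ∑ m ∈ Finset.Icc 1 (N / l), v' l * u m * apPhase f d (θ * k) (l * m) := by
      intro k
      have h1 : (Finset.Icc 1 N).filter (fun l => Nat.log 2 l = i) ⊆
          Finset.Ico (2 ^ i) (2 * 2 ^ i) := by
        intro l hl
        rw [Finset.mem_filter, Finset.mem_Icc] at hl
        have h2 := Nat.pow_log_le_self 2 (show l ≠ 0 by omega)
        have h3 := Nat.lt_pow_succ_log_self (b := 2) (by norm_num) l
        rw [hl.2] at h2 h3
        rw [pow_succ] at h3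
        rw [Finset.mem_Ico]
        omega
      rw [← Finset.sum_subset h1 (f := fun l => ∑ m ∈ Finset.Icc 1 (N / l),
        v' l * u m * apPhase f d (θ * k) (l * m))]
      · refine Finset.sum_congr rfl fun l hl => ?_
        rw [Finset.mem_filter, Finset.mem_Icc] at hl
        simp only [v', if_pos hl.1.2]
      · intro l hl hl'
        have h2 := hmem l hl
        rw [Finset.mem_filter, Finset.mem_Icc] at hl'
        have h3 : ¬ l ≤ N := fun h => hl' ⟨⟨h2.1, h⟩, h2.2⟩
        simp [v', if_neg h3]
    simp only [heq]
    have h := D.typeII (2 ^ i) (by positivity) hiN u v' T T hu (by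
      intro l hl
      simp only [v']
      split_ifs with hlN
      · exact hv l (Finset.mem_Icc.2 ⟨(hmem l hl).1, hlN⟩)
      · simpa using hT.trans' zero_le_one)
    refine le_of_sq_le_sq (h.trans ?_) (by positivity)
    have h4 : (U : ℝ) ≤ 2 * 2 ^ i := by exact_mod_cast hex.2.le
    have h5 : (2 : ℝ) ^ i ≤ s := by exact_mod_cast hex.1
    have h6 : (N : ℝ) / (2 ^ i * d) ≤ 2 * (N / (U * d)) := by
      rw [mul_div_assoc', div_le_div_iff₀ (by positivity) (by positivity)]
      have : (N : ℝ) * (U * d) ≤ N * ((2 * 2 ^ i) * d) := by gcongr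
      linarith
    have h7 : (N : ℝ) * (N / ((2 ^ i : ℕ) * d) + N / q + d * (2 ^ i : ℕ) + q) ≤ 2 * R ^ 2 := by
      rw [hR2]
      push_cast
      have h8 : (d : ℝ) * 2 ^ i ≤ d * s := by gcongr
      have h9 : (0 : ℝ) ≤ N / q := by positivity
      have h10 : (0 : ℝ) ≤ d * s := by positivity
      have h11 : (0 : ℝ) ≤ q := by positivity
      have h12 : (N / (2 ^ i * d) + N / q + d * 2 ^ i + q : ℝ) ≤
          2 * (N / (U * d) + N / q + d * s + q) := by linarith
      nlinarith [(Nat.cast_nonneg N : (0 : ℝ) ≤ N)]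
    calc _ ≤ 33 * (T * T * T * H) ^ 2 * (2 * R ^ 2) := by gcongr
      _ ≤ 81 * (T * T * T * H) ^ 2 * R ^ 2 := by
        nlinarith [mul_nonneg (sq_nonneg (T * T * T * H)) (sq_nonneg R)]
      _ = _ := by ring
  calc _ ≤ ∑ k ∈ Finset.Icc 1 H, ∑ i ∈ Finset.range (Nat.log 2 N + 1),
      ‖∑ l ∈ (Finset.Icc 1 N).filter (fun l => Nat.log 2 l = i), ∑ m ∈ Finset.Icc 1 (N / l),
        v l * u m * apPhase f d (θ * k) (l * m)‖ := by
        refine Finset.sum_le_sum fun k _ => ?_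
        rw [← Finset.sum_fiberwise_of_maps_to hmaps]
        exact norm_sum_le _ _
    _ ≤ ((Nat.log 2 N + 1 : ℕ) : ℝ) * (9 * T ^ 3 * H * R) := by
        rw [Finset.sum_comm]
        refine (Finset.sum_le_card_nsmul _ _ _ hpiece).trans_eq ?_
        rw [Finset.card_range, nsmul_eq_mul]
    _ ≤ T * (9 * T ^ 3 * H * R) := by
        gcongr
        push_cast
        exact D.natLog_le
    _ = _ := by ring

end ExpSumData

namespace ExpSumData

variable {θ : ℝ} {N f d a q H : ℕ} {T : ℝ}

/-- Vaughan's estimate for exponential sums over primes in a residue class, on average over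
frequencies. -/
theorem sum_norm_vonMangoldt_le (D : ExpSumData θ N f d a q H T) (U s : ℕ) (hU : 0 < U)
    (hUN : U * U ≤ N) (hs : N < (s + 1) * (s + 1)) :
    ∑ k ∈ Finset.Icc 1 H, ‖∑ n ∈ Finset.Icc 1 N,
      (ArithmeticFunction.vonMangoldt n : ℂ) * apPhase f d (θ * k) n‖ ≤
      H * (200 * T ^ 4 * (U + N / q + d * (U * U) + q +
        √(N * (N / (U * d) + N / q + d * s + q)))) := by
  have hT := D.one_le_T
  have hH1 : (1 : ℝ) ≤ H := by exact_mod_cast D.H_pos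
  set Λ := ArithmeticFunction.vonMangoldt with hΛ
  set μ := ((ArithmeticFunction.moebius : ArithmeticFunction ℤ) : ArithmeticFunction ℝ) with hμ
  set ζ := ((ArithmeticFunction.zeta : ArithmeticFunction ℕ) : ArithmeticFunction ℝ) with hζ
  set A := lowPart U Λ with hA
  set μ₁ := lowPart U μ with hμ₁
  set B := Λ - A with hB
  set b := ζ * (μ - μ₁) with hb
  set B₁ := lowPart s B with hB₁
  set b₁ := lowPart s b with hb₁
  set b₂ := b - b₁ with hb₂
  have hid : Λ = A + μ₁ * ArithmeticFunction.log - μ₁ * A * ζ + B * b := vaughan_identity U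
  have hΛ0 : ∀ n, 0 ≤ Λ n := fun n => ArithmeticFunction.vonMangoldt_nonneg
  have hA0 : ∀ n, 0 ≤ A n ∧ A n ≤ Λ n := by
    intro n
    rw [hA, lowPart_apply]
    split_ifs
    · exact ⟨hΛ0 n, le_rfl⟩
    · exact ⟨le_rfl, hΛ0 n⟩
  have hBbd : ∀ n ∈ Finset.Icc 1 N, |B n| ≤ T := by
    intro n hn
    rw [hB, hA, sub_lowPart_apply]
    split_ifs
    · simpa using hT.trans' zero_le_one
    · rw [abs_of_nonneg (hΛ0 n)]
      exact D.vonMangoldt_le (Finset.mem_Icc.1 hn).2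
  have hμ1bd : ∀ n, |μ₁ n| ≤ 1 := by
    intro n
    rw [hμ₁, lowPart_apply]
    split_ifs
    · exact abs_moebius_cast_le n
    · simp
  have hμ2bd : ∀ n, |(μ - μ₁) n| ≤ 1 := by
    intro n
    rw [hμ₁, sub_lowPart_apply]
    split_ifs
    · simp
    · exact abs_moebius_cast_le n
  have hbsum : ∀ n, b n = ∑ i ∈ n.divisors, (μ - μ₁) i := fun n =>
    ArithmeticFunction.coe_zeta_mul_apply
  have hbbd : ∀ n ∈ Finset.Icc 1 N, |b n| ≤ T := by
    intro n hn
    rw [hbsum]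
    refine (Finset.abs_sum_le_sum_abs _ _).trans
      (le_trans ?_ (D.card_divisors_le hn))
    refine (Finset.sum_le_card_nsmul _ _ 1 fun i _ => hμ2bd i).trans_eq ?_
    simp
  -- Every divisor of n ≤ U is at most U, where μ - μ₁ vanishes. Hence both factors of the bilinear
  -- term are supported beyond U.
  have hb0 : ∀ n ≤ U, b n = 0 := by
    intro n hn
    rw [hbsum]
    refine Finset.sum_eq_zero fun i hi => ?_
    rw [hμ₁, sub_lowPart_apply, if_pos]
    exact (Nat.divisor_le hi).trans hn
  have hB0 : ∀ n ≤ U, B n = 0 := by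
    intro n hn
    rw [hB, hA, sub_lowPart_apply, if_pos hn]
  -- Since |μ₁| ≤ 1 and 0 ≤ A ≤ Λ, the convolution is dominated by the divisor sum of Λ, which is
  -- log n.
  have hcbd : ∀ n ∈ Finset.Icc 1 N, |(μ₁ * A) n| ≤ T := by
    intro n hn
    refine le_trans ?_ (D.log_natCast_le (Finset.mem_Icc.1 hn).2)
    rw [ArithmeticFunction.mul_apply, ← ArithmeticFunction.vonMangoldt_sum,
      ← Nat.sum_divisorsAntidiagonal' (fun _ i => ArithmeticFunction.vonMangoldt i)]
    refine (Finset.abs_sum_le_sum_abs _ _).trans (Finset.sum_le_sum fun z _ => ?_)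
    rw [abs_mul, abs_of_nonneg (hA0 z.2).1]
    calc _ ≤ 1 * Λ z.2 := mul_le_mul (hμ1bd _) (hA0 _).2 (hA0 _).1 zero_le_one
      _ = _ := one_mul _
  have hc0 : ∀ n, U * U < n → (μ₁ * A) n = 0 := by
    intro n hn
    rw [ArithmeticFunction.mul_apply]
    refine Finset.sum_eq_zero fun z hz => ?_
    rw [Nat.mem_divisorsAntidiagonal] at hz
    rw [hμ₁, hA, lowPart_apply, lowPart_apply]
    by_cases h1 : z.1 ≤ U
    · by_cases h2 : z.2 ≤ U
      · have := Nat.mul_le_mul h1 h2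
        omega
      · simp [h2]
    · simp [h1]
  have hsplit : ∀ k : ℕ, ∑ n ∈ Finset.Icc 1 N, (Λ n : ℂ) * apPhase f d (θ * k) n =
      ∑ n ∈ Finset.Icc 1 N, (A n : ℂ) * apPhase f d (θ * k) n +
      ∑ n ∈ Finset.Icc 1 N, ((μ₁ * ArithmeticFunction.log) n : ℂ) * apPhase f d (θ * k) n -
      ∑ n ∈ Finset.Icc 1 N, ((μ₁ * A * ζ) n : ℂ) * apPhase f d (θ * k) n +
      ∑ n ∈ Finset.Icc 1 N, ((b₁ * B) n : ℂ) * apPhase f d (θ * k) n +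
      ∑ n ∈ Finset.Icc 1 N, ((B₁ * b₂) n : ℂ) * apPhase f d (θ * k) n := by
    intro k
    -- In a product at most N < (s+1)² one factor is at most s. So B * b may be replaced by b₁ * B +
    -- B₁ * b₂, where the dyadic variable stays in (U, s]; with s near √N the term ds later gives
    -- N^(3/4) d^(1/2).
    have h0 : ∑ n ∈ Finset.Icc 1 N, (((B - B₁) * b₂) n : ℂ) * apPhase f d (θ * k) n = 0 := by
      rw [sum_arith_mul]
      refine Finset.sum_eq_zero fun m hm => Finset.sum_eq_zero fun l hl => ?_
      rw [hB₁, hb₂, hb₁, sub_lowPart_apply s B, sub_lowPart_apply s b]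
      rw [Finset.mem_Icc] at hm hl
      by_cases h1 : m ≤ s
      · simp [h1]
      by_cases h2 : l ≤ s
      · simp [h2]
      exfalso
      have h3 := (Nat.le_div_iff_mul_le (by omega)).1 hl.2
      have h4 : (s + 1) * (s + 1) ≤ l * m := Nat.mul_le_mul (by omega) (by omega)
      omega
    have hid' : Λ = A + μ₁ * ArithmeticFunction.log - μ₁ * A * ζ + b₁ * B + B₁ * b₂ +
        (B - B₁) * b₂ := by
      rw [hb₂]; linear_combination hid
    rw [← add_zero (∑ n ∈ Finset.Icc 1 N, (A n : ℂ) * apPhase f d (θ * k) n +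
      _ - _ + _ + _), ← h0]
    simp only [← Finset.sum_add_distrib, ← Finset.sum_sub_distrib]
    refine Finset.sum_congr rfl fun n _ => ?_
    have h5 : Λ n = A n + (μ₁ * ArithmeticFunction.log) n - (μ₁ * A * ζ) n + (b₁ * B) n +
        (B₁ * b₂) n + ((B - B₁) * b₂) n := by
      have h6 : (μ₁ * A * ζ) n + Λ n = A n + (μ₁ * ArithmeticFunction.log) n + (b₁ * B) n +
        (B₁ * b₂) n + ((B - B₁) * b₂) n := by
        simp only [← ArithmeticFunction.add_apply]
        congr 1
        linear_combination hid'
      linarith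
    rw [h5]; push_cast; ring
  have h1 : ∑ k ∈ Finset.Icc 1 H, ‖∑ n ∈ Finset.Icc 1 N, (A n : ℂ) * apPhase f d (θ * k) n‖ ≤
      H * (T * U) := by
    have h : ∀ k ∈ Finset.Icc 1 H,
        ‖∑ n ∈ Finset.Icc 1 N, (A n : ℂ) * apPhase f d (θ * k) n‖ ≤ T * U := by
      intro k _
      refine (norm_sum_le _ _).trans ?_
      have h2 : ∀ n ∈ Finset.Icc 1 N, ‖(A n : ℂ) * apPhase f d (θ * k) n‖ ≤
          if n ≤ U then T else 0 := by
        intro n hn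
        rw [norm_mul, Complex.norm_real, Real.norm_of_nonneg (hA0 n).1]
        split_ifs with hnU
        · have h3 := (hA0 n).2.trans (D.vonMangoldt_le (Finset.mem_Icc.1 hn).2)
          calc _ ≤ T * 1 := mul_le_mul h3 (norm_apPhase_le _ _ _ _) (norm_nonneg _) (by linarith)
            _ = T := mul_one T
        · rw [hA, lowPart_apply, if_neg hnU, zero_mul]
      refine (Finset.sum_le_sum h2).trans ?_
      rw [← Finset.sum_filter, Finset.sum_const, nsmul_eq_mul, mul_comm]
      gcongr
      calc _ ≤ (Finset.Icc 1 U).card := Finset.card_le_card fun n hn => by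
            rw [Finset.mem_filter, Finset.mem_Icc] at hn
            exact Finset.mem_Icc.2 ⟨hn.1.1, hn.2⟩
        _ = U := by simp
    refine (Finset.sum_le_card_nsmul _ _ _ h).trans_eq ?_
    simp
  have htypeI : ∀ (F G : ArithmeticFunction ℝ) (M : ℕ) (C₁ C₂ : ℝ), 0 < M → M ≤ N →
      (∀ n, M < n → F n = 0) → (∀ n ∈ Finset.Icc 1 M, |F n| ≤ C₁) → ∀ g : ℕ → ℝ, Monotone g →
      0 ≤ g 0 → g N ≤ C₂ → (∀ n, 0 < n → G n = g n) →
      ∑ k ∈ Finset.Icc 1 H, ‖∑ n ∈ Finset.Icc 1 N, ((F * G) n : ℂ) * apPhase f d (θ * k) n‖ ≤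
        64 * C₁ * C₂ * T ^ 3 * (H * N / q + H * (d * M) + q) := by
    intro F G M C₁ C₂ hM hMN hF0 hF g hg hg0 hgN hGg
    refine le_trans (le_of_eq (Finset.sum_congr rfl fun k _ => ?_))
      (D.typeI M hM hMN (fun n => (F n : ℂ)) C₁ (fun m hm => ?_) g hg hg0 C₂ hgN)
    · congr 1
      rw [sum_arith_mul]
      rw [← Finset.sum_subset (Finset.Icc_subset_Icc_right hMN)]
      · refine Finset.sum_congr rfl fun m _ => Finset.sum_congr rfl fun l hl => ?_
        rw [hGg l (by have := (Finset.mem_Icc.1 hl).1; omega)]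
      · intro m hm hm'
        refine Finset.sum_eq_zero fun l _ => ?_
        rw [hF0 m]
        · simp
        · rw [Finset.mem_Icc] at hm hm'
          omega
    · rw [Complex.norm_real]
      exact hF m hm
  have h2 := htypeI μ₁ ArithmeticFunction.log U 1 T hU (by nlinarith)
    (fun n hn => by rw [hμ₁, lowPart_apply, if_neg (by omega)]) (fun n _ => hμ1bd n)
    (fun n => Real.log n) (by
      intro x y hxy
      rcases Nat.eq_zero_or_pos x with rfl | hx
      · simpa using Real.log_natCast_nonneg y
      · exact Real.log_le_log (by exact_mod_cast hx) (by exact_mod_cast hxy)) (by simp)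
    (D.log_natCast_le le_rfl) (fun n _ => rfl)
  have h3 := htypeI (μ₁ * A) ζ (U * U) T 1 (by positivity) hUN hc0
    (fun n hn => hcbd n (Finset.Icc_subset_Icc_right hUN hn)) (fun _ => 1) monotone_const
    zero_le_one le_rfl (fun n hn => by
      rw [hζ, ArithmeticFunction.natCoe_apply, ArithmeticFunction.zeta_apply, if_neg (by omega)]
      simp)
  set R : ℝ := √(N * (N / (U * d) + N / q + d * s + q)) with hR
  have hbil : ∀ F G : ArithmeticFunction ℝ, (∀ n ∈ Finset.Icc 1 N, |F n| ≤ T) →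
      (∀ n ∈ Finset.Icc 1 N, |G n| ≤ T) → (∀ n, F n ≠ 0 → U < n ∧ n ≤ s) →
      ∑ k ∈ Finset.Icc 1 H, ‖∑ n ∈ Finset.Icc 1 N, ((F * G) n : ℂ) * apPhase f d (θ * k) n‖ ≤
        9 * T ^ 4 * H * R := by
    intro F G hF hG hF0
    simp only [sum_arith_mul]
    refine D.bilinear U s hU (fun n => (G n : ℂ)) (fun n => (F n : ℂ)) ?_ ?_ ?_
    · intro n hn; rw [Complex.norm_real]; exact hG n hn
    · intro n hn; rw [Complex.norm_real]; exact hF n hn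
    · intro n hn; exact hF0 n (by simpa using hn)
  have hlow : ∀ F : ArithmeticFunction ℝ, (∀ n ∈ Finset.Icc 1 N, |F n| ≤ T) →
      (∀ n ≤ U, F n = 0) → (∀ n ∈ Finset.Icc 1 N, |lowPart s F n| ≤ T) ∧
      (∀ n, lowPart s F n ≠ 0 → U < n ∧ n ≤ s) := by
    intro F hF hF0
    constructor
    · intro n hn
      rw [lowPart_apply]
      split_ifs
      · exact hF n hn
      · simpa using hT.trans' zero_le_one
    · intro n hn
      rw [lowPart_apply] at hn
      split_ifs at hn with hns
      · exact ⟨not_le.1 fun h => hn (hF0 n h), hns⟩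
      · exact absurd rfl hn
  have h4 := hbil b₁ B (hlow b hbbd hb0).1 hBbd (hlow b hbbd hb0).2
  have h5 := hbil B₁ b₂ (hlow B hBbd hB0).1 (fun n hn => by
      rw [hb₂, hb₁, sub_lowPart_apply]
      split_ifs
      · simpa using hT.trans' zero_le_one
      · exact hbbd n hn) (hlow B hBbd hB0).2
  have htot : ∑ k ∈ Finset.Icc 1 H, ‖∑ n ∈ Finset.Icc 1 N, (Λ n : ℂ) * apPhase f d (θ * k) n‖ ≤
      H * (T * U) + 64 * 1 * T * T ^ 3 * (H * N / q + H * (d * U) + q) +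
      64 * T * 1 * T ^ 3 * (H * N / q + H * (d * (U * U : ℕ)) + q) + 9 * T ^ 4 * H * R +
      9 * T ^ 4 * H * R := by
    have hsum := add_le_add (add_le_add (add_le_add (add_le_add h1 h2) h3) h4) h5
    simp only [← Finset.sum_add_distrib] at hsum
    refine le_trans (Finset.sum_le_sum fun k _ => ?_) hsum
    rw [hsplit k]
    refine (norm_add_le _ _).trans (add_le_add ((norm_add_le _ _).trans
      (add_le_add ((norm_sub_le _ _).trans (add_le_add (norm_add_le _ _) le_rfl)) le_rfl)) le_rfl)
  refine htot.trans ?_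
  have hUU : (U : ℝ) ≤ U * U := by
    have : (1 : ℝ) ≤ U := by exact_mod_cast hU
    nlinarith
  have hT4 : T ≤ T ^ 4 := le_self_pow₀ hT (by norm_num)
  have e1 : H * (T * U) ≤ H * (T ^ 4 * U) := by gcongr
  have e2 : (H : ℝ) * (d * U) ≤ H * (d * (U * U)) := by gcongr
  have e3 : (q : ℝ) ≤ H * q := by
    have : (0 : ℝ) ≤ q := by positivity
    nlinarith
  have e4 : T ^ 4 * (H * N / q + H * (d * U) + q) ≤
      T ^ 4 * (H * N / q + H * (d * (U * U)) + H * q) := by gcongr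
  have e5 : T ^ 4 * (H * N / q + H * (d * (U * U)) + q) ≤
      T ^ 4 * (H * N / q + H * (d * (U * U)) + H * q) := by gcongr
  have p1 : 0 ≤ H * (T ^ 4 * U) := by positivity
  have p2 : 0 ≤ T ^ 4 * (H * N / q + H * (d * (U * U)) + H * q) := by positivity
  have p3 : 0 ≤ T ^ 4 * (H * R) := by positivity
  push_cast
  have e6 : H * (200 * T ^ 4 * (U + N / q + d * (U * U) + q + R)) =
      200 * (H * (T ^ 4 * U)) + 200 * (T ^ 4 * (H * N / q + H * (d * (U * U)) + H * q)) +
      200 * (T ^ 4 * (H * R)) := by ring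
  rw [e6]
  nlinarith

end ExpSumData

/-! ### Choice of the cutoff and passage to primes -/

/-- The main error term, up to a factor `N ^ ε`. -/
noncomputable def expSumError (N q d : ℕ) : ℝ :=
  (N : ℝ) / (q : ℝ) ^ (1 / 2 : ℝ) + (N : ℝ) ^ (1 / 2 : ℝ) * (q : ℝ) ^ (1 / 2 : ℝ)
    + (N : ℝ) ^ (3 / 4 : ℝ) * (d : ℝ) ^ (1 / 2 : ℝ)
    + (N : ℝ) ^ (4 / 5 : ℝ) / (d : ℝ) ^ (1 / 5 : ℝ)

theorem expSumError_nonneg (N q d : ℕ) : 0 ≤ expSumError N q d := by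
  unfold expSumError; positivity

/-- Used to absorb the contribution of proper prime powers, and to show that the error term is at
least 1. -/
theorem sqrt_le_expSumError (N q d : ℕ) (hN : 0 < N) (hd : 0 < d) :
    √(N : ℝ) ≤ expSumError N q d := by
  have hN1 : (1 : ℝ) ≤ N := by exact_mod_cast hN
  have hd1 : (1 : ℝ) ≤ d := by exact_mod_cast hd
  have h1 : √(N : ℝ) ≤ (N : ℝ) ^ (3 / 4 : ℝ) := by
    rw [Real.sqrt_eq_rpow]
    exact Real.rpow_le_rpow_of_exponent_le hN1 (by norm_num)
  have h2 : (1 : ℝ) ≤ (d : ℝ) ^ (1 / 2 : ℝ) := Real.one_le_rpow hd1 (by norm_num)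
  have h3 : (N : ℝ) ^ (3 / 4 : ℝ) ≤ (N : ℝ) ^ (3 / 4 : ℝ) * (d : ℝ) ^ (1 / 2 : ℝ) :=
    le_mul_of_one_le_right (by positivity) h2
  have h4 : (0 : ℝ) ≤ (N : ℝ) / (q : ℝ) ^ (1 / 2 : ℝ) := by positivity
  have h5 : (0 : ℝ) ≤ (N : ℝ) ^ (1 / 2 : ℝ) * (q : ℝ) ^ (1 / 2 : ℝ) := by positivity
  have h6 : (0 : ℝ) ≤ (N : ℝ) ^ (4 / 5 : ℝ) / (d : ℝ) ^ (1 / 5 : ℝ) := by positivity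
  unfold expSumError
  linarith

/-- The cutoff balances dU² against N/(Ud)^(1/2): for U near N^(2/5) d^(-3/5) both have size N^(4/5)
d^(-1/5). -/
theorem exists_vaughan_cutoff (N q d : ℕ) (hN : 0 < N) (hd : 0 < d) (hq : 0 < q) (hqN : q ≤ N)
    (hdN : (d : ℝ) ≤ (N : ℝ) ^ (1 / 6 : ℝ)) :
    ∃ U : ℕ, 0 < U ∧ U * U ≤ N ∧
      U + N / q + d * (U * U) + q +
        √(N * (N / (U * d) + N / q + d * Nat.sqrt N + q)) ≤ 4 * expSumError N q d := by
  have hN1 : (1 : ℝ) ≤ N := by exact_mod_cast hN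
  have hd1 : (1 : ℝ) ≤ d := by exact_mod_cast hd
  have hq1 : (1 : ℝ) ≤ q := by exact_mod_cast hq
  -- With the bases N^(1/20), d^(1/10) and q^(1/2) every exponent that occurs is an integer.
  set n : ℝ := (N : ℝ) ^ (1 / 20 : ℝ) with hn
  set δ : ℝ := (d : ℝ) ^ (1 / 10 : ℝ) with hδ
  set r : ℝ := (q : ℝ) ^ (1 / 2 : ℝ) with hr
  have hn1 : 1 ≤ n := Real.one_le_rpow hN1 (by norm_num)
  have hδ1 : 1 ≤ δ := Real.one_le_rpow hd1 (by norm_num)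
  have hr1 : 1 ≤ r := Real.one_le_rpow hq1 (by norm_num)
  have hnp : ∀ j : ℕ, (N : ℝ) ^ ((1 / 20 : ℝ) * j) = n ^ j := fun j => by
    rw [Real.rpow_mul (by positivity), Real.rpow_natCast]
  have hδp : ∀ j : ℕ, (d : ℝ) ^ ((1 / 10 : ℝ) * j) = δ ^ j := fun j => by
    rw [Real.rpow_mul (by positivity), Real.rpow_natCast]
  have eN : (N : ℝ) = n ^ 20 := by rw [← hnp]; norm_num
  have ed : (d : ℝ) = δ ^ 10 := by rw [← hδp]; norm_num
  have eq' : (q : ℝ) = r ^ 2 := by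
    rw [hr, ← Real.rpow_natCast, ← Real.rpow_mul (by positivity)]; norm_num
  have eE : expSumError N q d = n ^ 20 / r + n ^ 10 * r + n ^ 15 * δ ^ 5 + n ^ 16 / δ ^ 2 := by
    unfold expSumError
    rw [← hr, ← hnp 10, ← hnp 15, ← hnp 16, ← hδp 5, ← hδp 2, ← eN]
    norm_num
  have hδn : δ ^ 6 ≤ n ^ 8 := by
    have h1 : (d : ℝ) ^ ((1 / 10 : ℝ) * (6 : ℕ)) ≤
        ((N : ℝ) ^ (1 / 6 : ℝ)) ^ ((1 / 10 : ℝ) * (6 : ℕ)) :=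
      Real.rpow_le_rpow (by positivity) hdN (by positivity)
    rw [hδp, ← Real.rpow_mul (by positivity)] at h1
    refine h1.trans ?_
    rw [← hnp]
    exact Real.rpow_le_rpow_of_exponent_le hN1 (by norm_num)
  -- This is N^(2/5)/d^(3/5); the bound d ≤ N^(1/6) makes it at least 1, so its floor is positive
  -- and loses at most a factor 2.
  set u : ℝ := n ^ 8 / δ ^ 6 with hu
  have hu1 : 1 ≤ u := by rw [hu, one_le_div (by positivity)]; exact hδn
  have hU1 : 0 < ⌊u⌋₊ := Nat.floor_pos.2 hu1
  have hUu : ((⌊u⌋₊ : ℕ) : ℝ) ≤ u := Nat.floor_le (by linarith)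
  have hU2 : u ≤ 2 * (⌊u⌋₊ : ℕ) := by
    have h1 := Nat.lt_floor_add_one u
    have h2 : (1 : ℝ) ≤ (⌊u⌋₊ : ℕ) := by exact_mod_cast hU1
    linarith
  have huu : u * u = n ^ 16 / δ ^ 12 := by rw [hu]; field_simp
  refine ⟨⌊u⌋₊, hU1, ?_, ?_⟩
  · have h1 : ((⌊u⌋₊ : ℕ) : ℝ) * (⌊u⌋₊ : ℕ) ≤ N := by
      calc _ ≤ u * u := by gcongr
        _ = n ^ 16 / δ ^ 12 := huu
        _ ≤ n ^ 16 := div_le_self (by positivity) (one_le_pow₀ hδ1)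
        _ ≤ n ^ 20 := pow_le_pow_right₀ hn1 (by norm_num)
        _ = N := eN.symm
    exact_mod_cast h1
  have hrn : r ≤ n ^ 10 := by
    have h1 : r ^ 2 ≤ (n ^ 10) ^ 2 := by
      rw [← eq', ← pow_mul, ← eN]; exact_mod_cast hqN
    exact (pow_le_pow_iff_left₀ (by positivity) (by positivity) (by norm_num)).1 h1
  have hs : ((Nat.sqrt N : ℕ) : ℝ) ≤ n ^ 10 := by
    have h1 : ((Nat.sqrt N : ℕ) : ℝ) ^ 2 ≤ (n ^ 10) ^ 2 := by
      rw [← pow_mul, ← eN]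
      exact_mod_cast Nat.sqrt_le' N
    exact (pow_le_pow_iff_left₀ (by positivity) (by positivity) (by norm_num)).1 h1
  set X₁ := n ^ 20 / r
  set X₂ := n ^ 10 * r
  set X₃ := n ^ 15 * δ ^ 5
  set X₄ := n ^ 16 / δ ^ 2
  have hX₁ : 0 ≤ X₁ := by positivity
  have hX₂ : 0 ≤ X₂ := by positivity
  have hX₃ : 0 ≤ X₃ := by positivity
  have hX₄ : 0 ≤ X₄ := by positivity
  have t1 : ((⌊u⌋₊ : ℕ) : ℝ) ≤ X₄ := by
    refine hUu.trans ?_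
    calc u ≤ n ^ 8 / δ ^ 2 := by
          rw [hu]
          exact div_le_div_of_nonneg_left (by positivity) (by positivity)
            (pow_le_pow_right₀ hδ1 (by norm_num))
      _ ≤ X₄ := by
          simp only [X₄]
          exact div_le_div_of_nonneg_right (pow_le_pow_right₀ hn1 (by norm_num)) (by positivity)
  have t2 : (N : ℝ) / q ≤ X₁ := by
    rw [eN, eq']
    exact div_le_div_of_nonneg_left (by positivity) (by positivity)
      (le_self_pow₀ hr1 (by norm_num))
  have t3 : (d : ℝ) * ((⌊u⌋₊ : ℕ) * (⌊u⌋₊ : ℕ)) ≤ X₄ := by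
    calc _ ≤ δ ^ 10 * (u * u) := by rw [ed]; gcongr
      _ = X₄ := by rw [huu]; simp only [X₄]; field_simp
  have t4 : (q : ℝ) ≤ X₂ := by
    rw [eq', sq]
    simp only [X₂]
    gcongr
  have t5 : √((N : ℝ) * (N / ((⌊u⌋₊ : ℕ) * d) + N / q + d * Nat.sqrt N + q)) ≤
      2 * (X₁ + X₂ + X₃ + X₄) := by
    refine Real.sqrt_le_iff.2 ⟨by positivity, ?_⟩
    have h1 : (N : ℝ) / ((⌊u⌋₊ : ℕ) * d) ≤ 2 * (n ^ 12 / δ ^ 4) := by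
      have h2 : u * d ≤ 2 * ((⌊u⌋₊ : ℕ) * d) := by
        rw [← mul_assoc]; gcongr
      have h3 : u * d = n ^ 8 * δ ^ 4 := by rw [hu, ed]; field_simp
      rw [div_le_iff₀ (by positivity)]
      calc (N : ℝ) = n ^ 12 / δ ^ 4 * (u * d) := by rw [h3, eN]; field_simp
        _ ≤ n ^ 12 / δ ^ 4 * (2 * ((⌊u⌋₊ : ℕ) * d)) := by gcongr
        _ = _ := by ring
    have h4 : (N : ℝ) * (N / ((⌊u⌋₊ : ℕ) * d) + N / q + d * Nat.sqrt N + q) ≤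
        n ^ 20 * (2 * (n ^ 12 / δ ^ 4) + n ^ 20 / r ^ 2 + δ ^ 10 * n ^ 10 + r ^ 2) := by
      rw [← ed, ← eq', ← eN]
      gcongr
    have h5 : n ^ 20 * (2 * (n ^ 12 / δ ^ 4) + n ^ 20 / r ^ 2 + δ ^ 10 * n ^ 10 + r ^ 2) =
        2 * X₄ ^ 2 + X₁ ^ 2 + X₃ ^ 2 + X₂ ^ 2 := by
      simp only [X₁, X₂, X₃, X₄]
      field_simp
    rw [h5] at h4
    refine h4.trans ?_
    nlinarith [mul_nonneg hX₁ hX₂, mul_nonneg hX₁ hX₃, mul_nonneg hX₁ hX₄, mul_nonneg hX₂ hX₃,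
      mul_nonneg hX₂ hX₄, mul_nonneg hX₃ hX₄]
  rw [eE]
  linarith

/-- The exponential sum over the primes `p ≤ N` with `p ≡ f (mod d)`, weighted with `log p`. -/
noncomputable def primeExpSum (N f d : ℕ) (x : ℝ) : ℂ :=
  ∑ p ∈ (Finset.Icc 1 N).filter (fun p : ℕ => p.Prime ∧ p ≡ f [MOD d]),
    (Real.log p : ℂ) * expi (x * p)

/-- Only non-prime n remain, and their total weight is at most ψ(N) - θ(N) in Chebyshev's notation.
-/
theorem norm_sum_vonMangoldt_sub_primeExpSum_le (N f d : ℕ) (hN : 0 < N) (x : ℝ) :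
    ‖∑ n ∈ Finset.Icc 1 N, (ArithmeticFunction.vonMangoldt n : ℂ) * apPhase f d x n -
      primeExpSum N f d x‖ ≤ 2 * √(N : ℝ) * Real.log N := by
  refine le_trans ?_ (Chebyshev.psi_sub_theta_le (x := N) (by exact_mod_cast hN))
  rw [Chebyshev.psi_sub_theta_eq_sum_not_prime, Nat.floor_natCast]
  have h1 : primeExpSum N f d x = ∑ n ∈ (Finset.Icc 1 N).filter Nat.Prime,
      (ArithmeticFunction.vonMangoldt n : ℂ) * apPhase f d x n := by
    unfold primeExpSum apPhase
    rw [← Finset.filter_filter, Finset.sum_filter]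
    refine Finset.sum_congr rfl fun p hp => ?_
    rw [ArithmeticFunction.vonMangoldt_apply_prime (Finset.mem_filter.1 hp).2]
    split_ifs <;> simp
  rw [h1, ← Finset.sum_filter_add_sum_filter_not (Finset.Icc 1 N) Nat.Prime, add_sub_cancel_left]
  refine (norm_sum_le _ _).trans (Finset.sum_le_sum fun n _ => ?_)
  rw [norm_mul, Complex.norm_real,
    Real.norm_of_nonneg ArithmeticFunction.vonMangoldt_nonneg]
  exact mul_le_of_le_one_right ArithmeticFunction.vonMangoldt_nonneg (norm_apPhase_le _ _ _ _)

theorem ExpSumData.sum_norm_primeExpSum_le {θ : ℝ} {N f d a q H : ℕ} {T : ℝ}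
    (D : ExpSumData θ N f d a q H T) (hdN : (d : ℝ) ≤ (N : ℝ) ^ (1 / 6 : ℝ)) :
    ∑ k ∈ Finset.Icc 1 H, ‖primeExpSum N f d (θ * k)‖ ≤
      H * (802 * T ^ 4 * expSumError N q d) := by
  have hT := D.one_le_T
  have hN : 0 < N := by have := D.two_le_N; omega
  obtain ⟨U, hU, hUN, hUE⟩ := exists_vaughan_cutoff N q d hN D.d_pos D.q_pos D.q_le hdN
  have h1 := D.sum_norm_vonMangoldt_le U (Nat.sqrt N) hU hUN (Nat.lt_succ_sqrt N)
  have hE := expSumError_nonneg N q d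
  have h2 : ∑ k ∈ Finset.Icc 1 H, ‖primeExpSum N f d (θ * k)‖ ≤
      ∑ k ∈ Finset.Icc 1 H, (‖∑ n ∈ Finset.Icc 1 N,
        (ArithmeticFunction.vonMangoldt n : ℂ) * apPhase f d (θ * k) n‖ +
        2 * T * expSumError N q d) := by
    refine Finset.sum_le_sum fun k _ => ?_
    have h3 := norm_sum_vonMangoldt_sub_primeExpSum_le N f d hN (θ * k)
    have h4 := norm_sub_norm_le (primeExpSum N f d (θ * k)) (∑ n ∈ Finset.Icc 1 N,
        (ArithmeticFunction.vonMangoldt n : ℂ) * apPhase f d (θ * k) n)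
    rw [norm_sub_rev] at h4
    have h5 : 2 * √(N : ℝ) * Real.log N ≤ 2 * expSumError N q d * T := by
      have := sqrt_le_expSumError N q d hN D.d_pos
      have := D.log_natCast_le (n := N) le_rfl
      have : 0 ≤ Real.log N := Real.log_natCast_nonneg N
      gcongr
    linarith
  refine h2.trans ?_
  rw [Finset.sum_add_distrib, Finset.sum_const, Nat.card_Icc, Nat.add_sub_cancel, nsmul_eq_mul]
  have h6 : H * (200 * T ^ 4 * (U + N / q + d * (U * U) + q +
        √(N * (N / (U * d) + N / q + d * Nat.sqrt N + q)))) ≤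
      H * (200 * T ^ 4 * (4 * expSumError N q d)) := by gcongr
  have h7 : H * (2 * T * expSumError N q d) ≤ H * (2 * T ^ 4 * expSumError N q d) := by
    gcongr
    exact le_self_pow₀ hT (by norm_num)
  linarith

/-! ### The sawtooth function through an absolutely convergent Fourier series -/

/-- The convex piecewise linear primitive of the floor function lies above its chords' slopes. -/
theorem floor_mul_le_floor_primitive_sub (x y : ℝ) :
    (⌊x⌋ : ℝ) * (y - x) ≤
      (y ^ 2 - y - (Int.fract y ^ 2 - Int.fract y)) / 2 -
        (x ^ 2 - x - (Int.fract x ^ 2 - Int.fract x)) / 2 := by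
  have key : ∀ z : ℝ, (z ^ 2 - z - (Int.fract z ^ 2 - Int.fract z)) / 2 =
      ⌊z⌋ * z - ⌊z⌋ * (⌊z⌋ + 1) / 2 := by
    intro z
    have := Int.floor_add_fract z
    have h : Int.fract z = z - ⌊z⌋ := by linarith
    rw [h]; ring
  rw [key, key]
  have h1 := Int.floor_le y
  have h2 := Int.lt_floor_add_one y
  rcases lt_trichotomy ⌊x⌋ ⌊y⌋ with h | h | h
  · have h3 : (⌊x⌋ : ℝ) + 1 ≤ ⌊y⌋ := by exact_mod_cast h
    nlinarith [mul_nonneg (show (0 : ℝ) ≤ ⌊y⌋ - ⌊x⌋ by linarith) (show (0 : ℝ) ≤ y - ⌊y⌋ by linarith),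
      mul_nonneg (show (0 : ℝ) ≤ ⌊y⌋ - ⌊x⌋ by linarith) (show (0 : ℝ) ≤ ⌊y⌋ - ⌊x⌋ - 1 by linarith)]
  · rw [h]; linarith
  · have h3 : (⌊y⌋ : ℝ) + 1 ≤ ⌊x⌋ := by exact_mod_cast h
    nlinarith [mul_nonneg (show (0 : ℝ) ≤ ⌊x⌋ - ⌊y⌋ by linarith)
        (show (0 : ℝ) ≤ ⌊y⌋ + 1 - y by linarith),
      mul_nonneg (show (0 : ℝ) ≤ ⌊x⌋ - ⌊y⌋ by linarith) (show (0 : ℝ) ≤ ⌊x⌋ - ⌊y⌋ - 1 by linarith)]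

/-- This is the Fourier expansion of the second Bernoulli polynomial on [0, 1], extended by
periodicity. -/
theorem hasSum_cos_div_sq (x : ℝ) :
    HasSum (fun k : ℕ => 1 / (k : ℝ) ^ 2 * Real.cos (2 * Real.pi * k * x))
      (Real.pi ^ 2 * (Int.fract x ^ 2 - Int.fract x + 6⁻¹)) := by
  have h := hasSum_one_div_nat_pow_mul_cos (k := 1) one_ne_zero
    (x := Int.fract x) ⟨Int.fract_nonneg x, (Int.fract_lt_one x).le⟩
  have h2 := bernoulliFun_two (Int.fract x)
  unfold bernoulliFun at h2
  rw [mul_one, h2] at h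
  convert h using 1
  · funext k
    congr 1
    have h3 : 2 * Real.pi * k * Int.fract x =
        2 * Real.pi * k * x - ((k * ⌊x⌋ : ℤ) : ℝ) * (2 * Real.pi) := by
      rw [Int.fract]; push_cast; ring
    rw [h3, Real.cos_sub_int_mul_two_pi]
  · rw [Nat.factorial_two]
    push_cast
    ring

theorem norm_expi_sub_one_le (x : ℝ) : ‖expi x - 1‖ ≤ 2 * Real.pi * |x| := by
  rw [expi, mul_comm, Complex.norm_exp_I_mul_ofReal_sub_one, Real.norm_eq_abs, abs_mul, abs_two]
  have h := Real.abs_sin_le_abs (x := 2 * Real.pi * x / 2)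
  have h2 : |2 * Real.pi * x / 2| = Real.pi * |x| := by
    rw [show 2 * Real.pi * x / 2 = Real.pi * x by ring, abs_mul, abs_of_pos Real.pi_pos]
  linarith

theorem sum_Ioc_one_div_sq_le (K n : ℕ) (hK : 0 < K) :
    ∑ k ∈ Finset.Ioc K n, 1 / (k : ℝ) ^ 2 ≤ 1 / (K : ℝ) := by
  rcases le_total K n with h | h
  · have h1 := sum_Ioc_inv_sq_le_sub (α := ℝ) hK.ne' h
    simp only [one_div]
    have h2 : (0 : ℝ) ≤ (n : ℝ)⁻¹ := by positivity
    linarith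
  · rw [Finset.Ioc_eq_empty_of_le h]
    simp

/-- Weighted sums of the second difference of the periodic quadratic polynomial. -/
theorem abs_sum_fract_sq_sub_le (s : Finset ℕ) (w : ℕ → ℝ) (hw : ∀ p ∈ s, 0 ≤ w p) (θ c δ : ℝ)
    (hδ : 0 < δ) (K : ℕ) (hK : 0 < K) :
    |∑ p ∈ s, w p * ((Int.fract (-θ * p + c + δ) ^ 2 - Int.fract (-θ * p + c + δ)) -
      (Int.fract (-θ * p + c) ^ 2 - Int.fract (-θ * p + c)))| ≤
      2 * δ * (∑ k ∈ Finset.Icc 1 K, ‖∑ p ∈ s, (w p : ℂ) * expi (θ * k * p)‖ / k +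
        (∑ p ∈ s, w p) / (δ * K)) := by
  set W := ∑ p ∈ s, w p with hW
  have hW0 : 0 ≤ W := Finset.sum_nonneg hw
  set S : ℕ → ℂ := fun k => ∑ p ∈ s, (w p : ℂ) * expi (θ * k * p) with hS
  set t : ℕ → ℝ := fun k => ∑ p ∈ s, w p * (1 / (k : ℝ) ^ 2 *
    Real.cos (2 * Real.pi * k * (-θ * p + c + δ)) -
      1 / (k : ℝ) ^ 2 * Real.cos (2 * Real.pi * k * (-θ * p + c))) with ht
  have hsum : HasSum t (∑ p ∈ s, w p *
      (Real.pi ^ 2 * (Int.fract (-θ * p + c + δ) ^ 2 - Int.fract (-θ * p + c + δ) + 6⁻¹) -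
      Real.pi ^ 2 * (Int.fract (-θ * p + c) ^ 2 - Int.fract (-θ * p + c) + 6⁻¹))) :=
    hasSum_sum fun p _ => ((hasSum_cos_div_sq _).sub (hasSum_cos_div_sq _)).mul_left _
  set Q := ∑ p ∈ s, w p * ((Int.fract (-θ * p + c + δ) ^ 2 - Int.fract (-θ * p + c + δ)) -
      (Int.fract (-θ * p + c) ^ 2 - Int.fract (-θ * p + c))) with hQ
  have hval : ∑ p ∈ s, w p *
      (Real.pi ^ 2 * (Int.fract (-θ * p + c + δ) ^ 2 - Int.fract (-θ * p + c + δ) + 6⁻¹) -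
      Real.pi ^ 2 * (Int.fract (-θ * p + c) ^ 2 - Int.fract (-θ * p + c) + 6⁻¹)) =
      Real.pi ^ 2 * Q := by
    rw [hQ, Finset.mul_sum]
    exact Finset.sum_congr rfl fun p _ => by ring
  rw [hval] at hsum
  -- For k ≤ K the difference of cosines gains a factor kδ from |e(kδ) - 1| ≤ 2πkδ, turning 1/k²
  -- into δ/k.
  have hterm1 : ∀ k : ℕ, |t k| ≤ 1 / (k : ℝ) ^ 2 * (2 * Real.pi * (k * δ) * ‖S k‖) := by
    intro k
    have h1 : t k = 1 / (k : ℝ) ^ 2 *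
        (expi (-(k * c)) * (expi (-(k * δ)) - 1) * S k).re := by
      rw [ht, hS]
      simp only
      rw [Finset.mul_sum, Complex.re_sum, Finset.mul_sum]
      refine Finset.sum_congr rfl fun p _ => ?_
      have h2 : expi (-(k * c)) * (expi (-(k * δ)) - 1) * ((w p : ℂ) * expi (θ * k * p)) =
          (w p : ℂ) * (expi (-(k * (-θ * p + c + δ))) - expi (-(k * (-θ * p + c)))) := by
        have h3 : expi (-(k * (-θ * p + c + δ))) =
            expi (-(k * c)) * expi (-(k * δ)) * expi (θ * k * p) := by
          rw [← expi_add, ← expi_add]; congr 1; ring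
        have h4 : expi (-(k * (-θ * p + c))) = expi (-(k * c)) * expi (θ * k * p) := by
          rw [← expi_add]; congr 1; ring
        rw [h3, h4]; ring
      rw [h2, Complex.re_ofReal_mul, Complex.sub_re, expi_re, expi_re]
      rw [← Real.cos_neg (2 * Real.pi * -(k * (-θ * p + c + δ))),
        ← Real.cos_neg (2 * Real.pi * -(k * (-θ * p + c)))]
      have e1 : -(2 * Real.pi * -(k * (-θ * p + c + δ))) =
        2 * Real.pi * k * (-θ * p + c + δ) := by ring
      have e2 : -(2 * Real.pi * -(k * (-θ * p + c))) = 2 * Real.pi * k * (-θ * p + c) := by ring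
      rw [e1, e2]; ring
    rw [h1, abs_mul, abs_of_nonneg (by positivity : (0 : ℝ) ≤ 1 / (k : ℝ) ^ 2)]
    refine mul_le_mul_of_nonneg_left ((Complex.abs_re_le_norm _).trans ?_) (by positivity)
    rw [norm_mul, norm_mul, norm_expi, one_mul]
    have h5 := norm_expi_sub_one_le (-(k * δ))
    rw [abs_neg, abs_of_nonneg (by positivity)] at h5
    gcongr
  -- For k > K the trivial bound suffices: the tail of the sum of 1/k² is at most 1/K.
  have hterm2 : ∀ k : ℕ, |t k| ≤ 2 * W * (1 / (k : ℝ) ^ 2) := by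
    intro k
    refine (Finset.abs_sum_le_sum_abs _ _).trans ?_
    have h1 : ∀ p ∈ s, |w p * (1 / (k : ℝ) ^ 2 *
        Real.cos (2 * Real.pi * k * (-θ * p + c + δ)) -
        1 / (k : ℝ) ^ 2 * Real.cos (2 * Real.pi * k * (-θ * p + c)))| ≤
        w p * (2 * (1 / (k : ℝ) ^ 2)) := by
      intro p hp
      rw [abs_mul, abs_of_nonneg (hw p hp), ← mul_sub, abs_mul,
        abs_of_nonneg (by positivity : (0 : ℝ) ≤ 1 / (k : ℝ) ^ 2), mul_comm 2 (1 / (k : ℝ) ^ 2)]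
      have h2 : |Real.cos (2 * Real.pi * k * (-θ * p + c + δ)) -
          Real.cos (2 * Real.pi * k * (-θ * p + c))| ≤ 2 := by
        rw [abs_le]
        constructor <;>
        linarith [Real.cos_le_one (2 * Real.pi * k * (-θ * p + c + δ)),
          Real.cos_le_one (2 * Real.pi * k * (-θ * p + c)),
          Real.neg_one_le_cos (2 * Real.pi * k * (-θ * p + c + δ)),
          Real.neg_one_le_cos (2 * Real.pi * k * (-θ * p + c))]
      have := hw p hp
      gcongr
    refine (Finset.sum_le_sum h1).trans_eq ?_
    rw [← Finset.sum_mul]; ring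
  have hbound : |Real.pi ^ 2 * Q| ≤
      2 * Real.pi * δ * ∑ k ∈ Finset.Icc 1 K, ‖S k‖ / k + 2 * W * (1 / K) := by
    refine le_of_tendsto hsum.tendsto_sum_nat.abs (Eventually.of_forall fun n => ?_)
    refine (Finset.abs_sum_le_sum_abs _ _).trans ?_
    have h0 : |t 0| = 0 := by simp [ht]
    calc ∑ k ∈ Finset.range n, |t k|
        ≤ ∑ k ∈ Finset.Icc 1 K ∪ Finset.Ioc K n, |t k| := by
          rw [← Finset.sum_erase (f := fun k => |t k|) _ h0]
          refine Finset.sum_le_sum_of_subset_of_nonneg (fun k hk => ?_) fun _ _ _ => abs_nonneg _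
          simp only [Finset.mem_erase, Finset.mem_range, Finset.mem_union, Finset.mem_Icc,
            Finset.mem_Ioc] at hk ⊢
          omega
      _ = ∑ k ∈ Finset.Icc 1 K, |t k| + ∑ k ∈ Finset.Ioc K n, |t k| := by
          refine Finset.sum_union (Finset.disjoint_left.2 fun k hk hk' => ?_)
          rw [Finset.mem_Icc] at hk
          rw [Finset.mem_Ioc] at hk'
          omega
      _ ≤ _ := by
          refine add_le_add ?_ ?_
          · rw [Finset.mul_sum]
            refine Finset.sum_le_sum fun k hk => (hterm1 k).trans_eq ?_
            have : (k : ℝ) ≠ 0 := by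
              have := (Finset.mem_Icc.1 hk).1
              positivity
            field_simp
          · refine (Finset.sum_le_sum fun k _ => hterm2 k).trans ?_
            rw [← Finset.mul_sum]
            exact mul_le_mul_of_nonneg_left (sum_Ioc_one_div_sq_le K n hK) (by positivity)
  have hK' : (0 : ℝ) < K := by exact_mod_cast hK
  have hπ : 3 < Real.pi := Real.pi_gt_three
  rw [abs_mul, abs_of_nonneg (by positivity : (0 : ℝ) ≤ Real.pi ^ 2)] at hbound
  set A := ∑ k ∈ Finset.Icc 1 K, ‖S k‖ / k with hA
  have hA0 : 0 ≤ A := Finset.sum_nonneg fun k _ => by positivity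
  have e : 2 * δ * (A + W / (δ * K)) = 2 * (δ * A) + 2 * (W * (1 / K)) := by
    field_simp
  rw [e]
  have p1 : 0 ≤ δ * A := by positivity
  have p2 : 0 ≤ W * (1 / K) := by positivity
  have hπ2 : 0 < Real.pi ^ 2 := by positivity
  refine le_of_mul_le_mul_left (hbound.trans ?_) hπ2
  have p3 : Real.pi * (δ * A) ≤ Real.pi ^ 2 * (δ * A) := by
    gcongr; exact le_self_pow₀ (by linarith) (by norm_num)
  have p4 : W * (1 / K) ≤ Real.pi ^ 2 * (W * (1 / K)) :=
    le_mul_of_one_le_left p2 (one_le_pow₀ (by linarith))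
  linarith

/-- A weighted sum of floors, in terms of exponential sums. -/
theorem abs_sum_floor_sub_le (s : Finset ℕ) (w : ℕ → ℝ) (hw : ∀ p ∈ s, 0 ≤ w p) (θ c δ : ℝ)
    (hδ : 0 < δ) (K : ℕ) (hK : 0 < K) :
    |∑ p ∈ s, w p * (⌊-θ * p + c⌋ - (-θ * p + c) + 1 / 2)| ≤
      δ * (∑ p ∈ s, w p) +
        (∑ k ∈ Finset.Icc 1 K, ‖∑ p ∈ s, (w p : ℂ) * expi (θ * k * p)‖ / k +
        (∑ p ∈ s, w p) / (δ * K)) := by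
  set W := ∑ p ∈ s, w p with hW
  have hW0 : 0 ≤ W := Finset.sum_nonneg hw
  set R := ∑ k ∈ Finset.Icc 1 K, ‖∑ p ∈ s, (w p : ℂ) * expi (θ * k * p)‖ / k + W / (δ * K) with hR
  have h1 := abs_sum_fract_sq_sub_le s w hw θ c δ hδ K hK
  have h2 := abs_sum_fract_sq_sub_le s w hw θ (c - δ) δ hδ K hK
  rw [← hW, ← hR, abs_le] at h1 h2
  set Q₁ := ∑ p ∈ s, w p * ((Int.fract (-θ * p + c + δ) ^ 2 - Int.fract (-θ * p + c + δ)) -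
      (Int.fract (-θ * p + c) ^ 2 - Int.fract (-θ * p + c))) with hQ₁
  set Q₂ := ∑ p ∈ s, w p * ((Int.fract (-θ * p + (c - δ) + δ) ^ 2 -
      Int.fract (-θ * p + (c - δ) + δ)) -
      (Int.fract (-θ * p + (c - δ)) ^ 2 - Int.fract (-θ * p + (c - δ)))) with hQ₂
  set V := ∑ p ∈ s, w p * (⌊-θ * p + c⌋ - (-θ * p + c) + 1 / 2) with hV
  -- For a step δ the chord inequality bounds ⌊x⌋δ by an increment of the primitive. Its quadratic
  -- part contributes δ(x - 1/2) + δ²/2 and its periodic part contributes Q₁; a step -δ gives the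
  -- reverse bound.
  have hup : 2 * δ * V ≤ δ ^ 2 * W - Q₁ := by
    rw [hV, hQ₁, hW, Finset.mul_sum, Finset.mul_sum, ← Finset.sum_sub_distrib]
    refine Finset.sum_le_sum fun p hp => ?_
    have h3 := floor_mul_le_floor_primitive_sub (-θ * p + c) (-θ * p + c + δ)
    have h4 := mul_le_mul_of_nonneg_left h3 (hw p hp)
    nlinarith
  have hlow : -(δ ^ 2 * W) - Q₂ ≤ 2 * δ * V := by
    rw [hV, hQ₂, hW, Finset.mul_sum, Finset.mul_sum, ← Finset.sum_neg_distrib,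
      ← Finset.sum_sub_distrib]
    refine Finset.sum_le_sum fun p hp => ?_
    have e : -θ * p + (c - δ) + δ = -θ * p + c := by ring
    rw [e]
    have h3 := floor_mul_le_floor_primitive_sub (-θ * p + c) (-θ * p + (c - δ))
    have h4 := mul_le_mul_of_nonneg_left h3 (hw p hp)
    nlinarith
  have hδW : 0 ≤ δ * W := by positivity
  rw [abs_le]
  constructor
  · have h5 : 2 * δ * (-(δ * W + R)) ≤ 2 * δ * V := by nlinarith
    exact le_of_mul_le_mul_left h5 (by positivity)
  · have h5 : 2 * δ * V ≤ 2 * δ * (δ * W + R) := by nlinarith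
    exact le_of_mul_le_mul_left h5 (by positivity)

/-- Partial summation for the weight `1 / k`. -/
theorem sum_div_le_of_sum_le (u : ℕ → ℝ) (B : ℝ) (hB : 0 ≤ B) (K : ℕ)
    (hu : ∀ H, 0 < H → H ≤ K → ∑ k ∈ Finset.Icc 1 H, u k ≤ H * B) :
    ∑ k ∈ Finset.Icc 1 K, u k / k ≤ B * (2 + Real.log K) := by
  have key : ∀ H ≤ K, ∑ k ∈ Finset.Icc 1 H, u k / k ≤
      (∑ k ∈ Finset.Icc 1 H, u k) / H + B * ∑ k ∈ Finset.Icc 1 H, 1 / (k : ℝ) := by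
    intro H
    induction H with
    | zero => simp
    | succ H ih =>
      intro hH
      have h1 := ih (by omega)
      rw [Finset.sum_Icc_succ_top (by omega), Finset.sum_Icc_succ_top (by omega),
        Finset.sum_Icc_succ_top (by omega)]
      set a := ∑ k ∈ Finset.Icc 1 H, u k with ha
      rcases Nat.eq_zero_or_pos H with rfl | hpos
      · simp [ha, hB]
      have h2 : a ≤ H * B := hu H hpos (by omega)
      have hH' : (0 : ℝ) < H := by exact_mod_cast hpos
      have h3 : a / H ≤ a / (H + 1) + B * (1 / (H + 1)) := by
        rw [mul_one_div, ← add_div, div_le_div_iff₀ hH' (by positivity)]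
        linarith
      push_cast
      rw [add_div, mul_add]
      linarith
  refine (key K le_rfl).trans ?_
  have h1 := sum_one_div_le_one_add_log K
  have h2 : (∑ k ∈ Finset.Icc 1 K, u k) / K ≤ B := by
    rcases Nat.eq_zero_or_pos K with rfl | hpos
    · simpa using hB
    · rw [div_le_iff₀ (by exact_mod_cast hpos)]
      linarith [hu K hpos le_rfl]
  have h3 := mul_le_mul_of_nonneg_left h1 hB
  linarith

/-! ### Detecting the Beatty sequence by floors -/

theorem floor_sub_floor_mem (γ x y : ℝ) (hγ0 : 0 < γ) (hγ1 : γ < 1) (h : x - y = γ) :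
    ⌊x⌋ - ⌊y⌋ = 0 ∨ ⌊x⌋ - ⌊y⌋ = 1 := by
  have h1 : ⌊y⌋ ≤ ⌊x⌋ := Int.floor_le_floor (by linarith)
  have h2 : ⌊x⌋ ≤ ⌊y⌋ + 1 := by
    rw [← Int.floor_add_one]
    exact Int.floor_le_floor (by linarith)
  omega

/-- If m = ⌊nα + β⌋, then -n is an integer separating the two arguments of the floors. -/
theorem one_le_floor_sub_of_mem_beatty (α β : ℝ) (hα : 1 < α) (m : ℕ)
    (hm : (m : ℤ) ∈ beatty α β) :
    1 ≤ ⌊-(1 / α) * m + 1 / α * β⌋ - ⌊-(1 / α) * m + 1 / α * (β - 1)⌋ := by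
  obtain ⟨n, -, hmn⟩ := hm
  have hα0 : 0 < α := by linarith
  have h1 := (Int.floor_eq_iff.1 hmn.symm).1
  have h2 := (Int.floor_eq_iff.1 hmn.symm).2
  push_cast at h1 h2
  have hinv : 1 / α * α = 1 := by field_simp
  have hpos : 0 < 1 / α := by positivity
  have h3 : -(n : ℤ) ≤ ⌊-(1 / α) * m + 1 / α * β⌋ := by
    rw [Int.le_floor]
    push_cast
    have := mul_le_mul_of_nonneg_left h1 hpos.le
    have e : 1 / α * (n * α + β) = n + 1 / α * β := by rw [mul_add]; field_simp
    linarith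
  have h4 : ⌊-(1 / α) * m + 1 / α * (β - 1)⌋ < -(n : ℤ) := by
    rw [Int.floor_lt]
    push_cast
    have := mul_lt_mul_of_pos_left h2 hpos
    have e : 1 / α * (n * α + β) = n + 1 / α * β := by rw [mul_add]; field_simp
    linarith
  omega

/-- The integer x in the interval supplies the index n = -x, and β < m makes x negative, so that n ≥
1. -/
theorem mem_beatty_of_one_le_floor_sub (α β : ℝ) (hα : 1 < α) (m : ℕ) (hβ : β < m)
    (hm : 1 ≤ ⌊-(1 / α) * m + 1 / α * β⌋ - ⌊-(1 / α) * m + 1 / α * (β - 1)⌋) :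
    (m : ℤ) ∈ beatty α β := by
  have hα0 : 0 < α := by linarith
  have hpos : 0 < 1 / α := by positivity
  set x := ⌊-(1 / α) * m + 1 / α * β⌋ with hx
  have hx1 : (x : ℝ) ≤ -(1 / α) * m + 1 / α * β := Int.floor_le _
  have hx0 : x < 0 := by
    rw [hx, Int.floor_lt]
    push_cast
    have := mul_lt_mul_of_pos_left hβ hpos
    linarith
  have hx2 : -(1 / α) * m + 1 / α * (β - 1) < x := by
    rw [← Int.floor_lt]; omega
  obtain ⟨n, hn⟩ : ∃ n : ℕ, (n : ℤ) = -x := ⟨(-x).toNat, by omega⟩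
  have hn' : (n : ℝ) = -x := by exact_mod_cast hn
  refine ⟨n, by omega, ?_⟩
  symm
  rw [Int.floor_eq_iff]
  push_cast
  have e1 : α * (-(1 / α) * m + 1 / α * β) = -m + β := by field_simp
  have e2 : α * (-(1 / α) * m + 1 / α * (β - 1)) = -m + (β - 1) := by field_simp
  have h1 := mul_le_mul_of_nonneg_left hx1 hα0.le
  have h2 := mul_lt_mul_of_pos_left hx2 hα0
  rw [e1] at h1
  rw [e2] at h2
  rw [hn']
  constructor <;> linarith

theorem log_four_le_two : Real.log 4 ≤ 2 := by
  have h : Real.log 4 = 2 * Real.log 2 := by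
    rw [show (4 : ℝ) = 2 ^ 2 by norm_num, Real.log_pow]; norm_num
  have := Real.log_two_lt_d9
  linarith

/-- Chebyshev's bound for a sum over a set of primes. -/
theorem sum_log_prime_le (s : Finset ℕ) (x : ℝ) (hx : 0 ≤ x)
    (hs : ∀ p ∈ s, p.Prime ∧ (p : ℝ) ≤ x) : ∑ p ∈ s, Real.log p ≤ 2 * x := by
  have h1 : ∑ p ∈ s, Real.log p ≤ Chebyshev.theta x := by
    rw [Chebyshev.theta_eq_sum_Icc]
    refine Finset.sum_le_sum_of_subset_of_nonneg (fun p hp => ?_)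
      fun p _ _ => Real.log_natCast_nonneg p
    rw [Finset.mem_filter, Finset.mem_Icc]
    exact ⟨⟨Nat.zero_le _, Nat.le_floor (hs p hp).2⟩, (hs p hp).1⟩
  have h2 := Chebyshev.theta_le_log4_mul_x hx
  have h3 := mul_le_mul_of_nonneg_right log_four_le_two hx
  linarith

theorem primeSum_nonneg (N f d : ℕ) : 0 ≤ primeSum N f d :=
  Finset.sum_nonneg fun p _ => Real.log_natCast_nonneg p

theorem primeSum_le (N f d : ℕ) : primeSum N f d ≤ 2 * N :=
  sum_log_prime_le _ _ (Nat.cast_nonneg N) fun p hp => by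
    rw [Finset.mem_filter, Finset.mem_Icc] at hp
    exact ⟨hp.2.1, by exact_mod_cast hp.1.2⟩

open scoped Classical in
theorem beattyPrimeSum_eq (α β : ℝ) (N f d : ℕ) :
    beattyPrimeSum α β N f d =
      ∑ p ∈ (Finset.Icc 1 N).filter (fun p : ℕ => p.Prime ∧ p ≡ f [MOD d]),
        Real.log p * (if (p : ℤ) ∈ beatty α β then 1 else 0) := by
  simp only [beattyPrimeSum, mul_ite, mul_one, mul_zero]
  rw [← Finset.sum_filter, Finset.filter_filter]
  refine Finset.sum_congr (Finset.filter_congr fun p _ => ?_) fun _ _ => rfl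
  tauto

/-- The trivial bound, sufficient when q > N. -/
theorem abs_beattyPrimeSum_sub_le_primeSum (α β : ℝ) (hα : 1 < α) (N f d : ℕ) :
    |beattyPrimeSum α β N f d - 1 / α * primeSum N f d| ≤ primeSum N f d := by
  classical
  have h0 : 0 ≤ beattyPrimeSum α β N f d :=
    Finset.sum_nonneg fun p _ => Real.log_natCast_nonneg p
  have h1 : beattyPrimeSum α β N f d ≤ primeSum N f d := by
    rw [beattyPrimeSum_eq]
    refine Finset.sum_le_sum fun p _ => ?_
    have := Real.log_natCast_nonneg p
    split_ifs <;> simp [this]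
  have h2 := primeSum_nonneg N f d
  have h3 : 1 / α ≤ 1 := by rw [div_le_one (by linarith)]; exact hα.le
  have h4 : 0 ≤ 1 / α := by positivity
  have h5 : 1 / α * primeSum N f d ≤ primeSum N f d := mul_le_of_le_one_left h2 h3
  have h6 : 0 ≤ 1 / α * primeSum N f d := by positivity
  rw [abs_le]
  constructor <;> linarith

/-- The Beatty condition removed at the cost of exponential sums. -/
theorem abs_beattyPrimeSum_sub_le (α β : ℝ) (hα : 1 < α) (hβ : 0 ≤ β) (N f d : ℕ) (hN : 0 < N)
    (R : ℝ) (hR : ∑ k ∈ Finset.Icc 1 (N ^ 2), ‖primeExpSum N f d (1 / α * k)‖ / k ≤ R) :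
    |beattyPrimeSum α β N f d - 1 / α * primeSum N f d| ≤ 2 * β + 8 + 2 * R := by
  classical
  set s := (Finset.Icc 1 N).filter (fun p : ℕ => p.Prime ∧ p ≡ f [MOD d]) with hs
  set γ := 1 / α with hγ
  have hγ0 : 0 < γ := by positivity
  have hγ1 : γ < 1 := by rw [hγ, div_lt_one (by linarith)]; exact hα
  have hN' : (0 : ℝ) < N := by exact_mod_cast hN
  -- With δ = 1/N and K = N², Chebyshev's bound 2N for the total weight makes both δW and W/(δK) at
  -- most 2.
  have hfl : ∀ c : ℝ, |∑ p ∈ s, Real.log p * (⌊-γ * p + c⌋ - (-γ * p + c) + 1 / 2)| ≤ 4 + R := by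
    intro c
    have h := abs_sum_floor_sub_le s (fun p => Real.log p) (fun p _ => Real.log_natCast_nonneg p)
      γ c (1 / N) (by positivity) (N ^ 2) (by positivity)
    refine h.trans ?_
    have h1 : ∑ p ∈ s, Real.log p ≤ 2 * N := primeSum_le N f d
    have h2 : (1 / N : ℝ) * ∑ p ∈ s, Real.log p ≤ 2 := by
      rw [one_div_mul_eq_div, div_le_iff₀ hN']; exact h1
    have h3 : (∑ p ∈ s, Real.log p) / (1 / N * (N ^ 2 : ℕ)) ≤ 2 := by
      have : (1 / N * (N ^ 2 : ℕ) : ℝ) = N := by push_cast; field_simp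
      rw [this, div_le_iff₀ hN']; exact h1
    have h4 : ∑ k ∈ Finset.Icc 1 (N ^ 2), ‖∑ p ∈ s, ((Real.log p : ℝ) : ℂ) *
        expi (γ * k * p)‖ / k ≤ R := hR
    linarith
  have h1 := hfl (γ * β)
  have h2 := hfl (γ * (β - 1))
  -- Indicator and floor difference can disagree only for p ≤ β, where an integer in the interval
  -- may fail to give n ≥ 1.
  have h3 : |∑ p ∈ s, Real.log p * ((if (p : ℤ) ∈ beatty α β then 1 else 0) -
      ((⌊-γ * p + γ * β⌋ : ℝ) - ⌊-γ * p + γ * (β - 1)⌋))| ≤ 2 * β := by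
    refine (Finset.abs_sum_le_sum_abs _ _).trans ?_
    have h4 : ∀ p ∈ s, |Real.log p * ((if (p : ℤ) ∈ beatty α β then 1 else 0) -
      ((⌊-γ * p + γ * β⌋ : ℝ) - ⌊-γ * p + γ * (β - 1)⌋))| ≤
        if (p : ℝ) ≤ β then Real.log p else 0 := by
      intro p _
      have hlog := Real.log_natCast_nonneg p
      rw [abs_mul, abs_of_nonneg hlog]
      have h5 := floor_sub_floor_mem γ (-γ * p + γ * β) (-γ * p + γ * (β - 1)) hγ0 hγ1 (by ring)
      have h6 := one_le_floor_sub_of_mem_beatty α β hα p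
      have h7 := mem_beatty_of_one_le_floor_sub α β hα p
      rw [← hγ] at h6 h7
      have hcast : ((⌊-γ * p + γ * β⌋ : ℝ) - ⌊-γ * p + γ * (β - 1)⌋) =
          ((⌊-γ * p + γ * β⌋ - ⌊-γ * p + γ * (β - 1)⌋ : ℤ) : ℝ) := by push_cast; ring
      rw [hcast]
      generalize ⌊-γ * p + γ * β⌋ - ⌊-γ * p + γ * (β - 1)⌋ = I at h5 h6 h7
      by_cases hmem : (p : ℤ) ∈ beatty α β
      · have h8 := h6 hmem
        have h9 : I = 1 := by omega
        rw [if_pos hmem, h9]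
        split_ifs <;> simp [hlog]
      · rw [if_neg hmem]
        rcases h5 with h5 | h5
        · rw [h5]; split_ifs <;> simp [hlog]
        · have h10 : (p : ℝ) ≤ β := by
            by_contra hc
            exact hmem (h7 (not_le.1 hc) h5.ge)
          rw [if_pos h10, h5]; simp
    refine (Finset.sum_le_sum h4).trans ?_
    rw [← Finset.sum_filter]
    refine sum_log_prime_le _ β hβ fun p hp => ?_
    rw [Finset.mem_filter, hs, Finset.mem_filter] at hp
    exact ⟨hp.1.2.1, hp.2⟩
  -- The linear parts of the two sawtooth sums differ by γ for each p, which is the main term.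
  have h4 : beattyPrimeSum α β N f d - γ * primeSum N f d =
      ∑ p ∈ s, Real.log p * ((if (p : ℤ) ∈ beatty α β then 1 else 0) -
      ((⌊-γ * p + γ * β⌋ : ℝ) - ⌊-γ * p + γ * (β - 1)⌋)) +
      ∑ p ∈ s, Real.log p * (⌊-γ * p + γ * β⌋ - (-γ * p + γ * β) + 1 / 2) -
      ∑ p ∈ s, Real.log p * (⌊-γ * p + γ * (β - 1)⌋ - (-γ * p + γ * (β - 1)) + 1 / 2) := by
    rw [beattyPrimeSum_eq, primeSum, Finset.mul_sum, ← Finset.sum_sub_distrib,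
      ← Finset.sum_add_distrib, ← Finset.sum_sub_distrib]
    exact Finset.sum_congr rfl fun p _ => by ring
  rw [h4]
  rw [abs_le] at h1 h2 h3 ⊢
  constructor <;> linarith

/-! ### The estimate for a given rational approximation -/

theorem exists_log_divisor_bound (η : ℝ) (hη : 0 < η) :
    ∃ C : ℝ, 1 ≤ C ∧ ∀ N : ℕ, 2 ≤ N → 1 + Real.log N ≤ C * (N : ℝ) ^ η ∧
      ((Nat.log 2 N : ℕ) : ℝ) + 1 ≤ C * (N : ℝ) ^ η ∧
      ∀ x ∈ Finset.Icc 1 (N ^ 5), (x.divisors.card : ℝ) ≤ C * (N : ℝ) ^ η := by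
  obtain ⟨C₀, hC₀, hdiv⟩ := exists_card_divisors_le_rpow (η / 5) (by positivity)
  refine ⟨C₀ + 2 + 2 / η, by have : 0 < 2 / η := by positivity
                             linarith, fun N hN => ?_⟩
  have hN1 : (1 : ℝ) ≤ N := by exact_mod_cast (by omega : 1 ≤ N)
  have hNη : 1 ≤ (N : ℝ) ^ η := Real.one_le_rpow hN1 hη.le
  have hlog := Real.log_le_rpow_div (x := N) (by positivity) hη
  have hlog0 : 0 ≤ Real.log N := Real.log_natCast_nonneg N
  have hdecomp : (C₀ + 2 + 2 / η) * (N : ℝ) ^ η =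
      C₀ * (N : ℝ) ^ η + 2 * (N : ℝ) ^ η + 2 * ((N : ℝ) ^ η / η) := by ring
  have p1 : 0 ≤ C₀ * (N : ℝ) ^ η := by positivity
  have p2 : 0 ≤ (N : ℝ) ^ η / η := by positivity
  rw [hdecomp]
  refine ⟨by linarith, ?_, fun x hx => ?_⟩
  · have h1 : ((Nat.log 2 N : ℕ) : ℝ) * Real.log 2 ≤ Real.log N := by
      rw [← Real.log_pow]
      refine Real.log_le_log (by positivity) ?_
      exact_mod_cast Nat.pow_log_le_self 2 (by omega)
    have h2 := Real.log_two_gt_d9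
    have h3 : (0 : ℝ) ≤ (Nat.log 2 N : ℕ) := by positivity
    nlinarith
  · rw [Finset.mem_Icc] at hx
    have h1 := hdiv x (by omega)
    have h2 : (x : ℝ) ^ (η / 5) ≤ ((N : ℝ) ^ 5) ^ (η / 5) :=
      Real.rpow_le_rpow (by positivity) (by exact_mod_cast hx.2) (by positivity)
    have h3 : ((N : ℝ) ^ 5) ^ (η / 5) = (N : ℝ) ^ η := by
      rw [← Real.rpow_natCast, ← Real.rpow_mul (by positivity)]
      congr 1; push_cast; ring
    rw [h3] at h2
    have h4 : C₀ * (x : ℝ) ^ (η / 5) ≤ C₀ * (N : ℝ) ^ η := by gcongr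
    linarith

/-- The estimate for primes in a Beatty sequence and a residue class, in terms of a rational
approximation. -/
theorem exists_abs_beattyPrimeSum_sub_le (α : ℝ) (hα : 1 < α) (hirr : Irrational α) (ε : ℝ)
    (hε : 0 < ε) : ∃ C : ℝ, 0 < C ∧ ∀ β : ℝ, 0 ≤ β → ∀ N f d a q : ℕ, 2 ≤ N → 0 < d →
      (d : ℝ) ≤ (N : ℝ) ^ (1 / 6 : ℝ) → Nat.Coprime f d → 0 < q → Nat.Coprime a q →
      |1 / α - (a : ℝ) / (q : ℝ)| ≤ 1 / (q : ℝ) ^ 2 →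
      |beattyPrimeSum α β N f d - 1 / α * primeSum N f d| ≤
        C * ((N : ℝ) ^ ε * expSumError N q d + β) := by
  -- The bound T enters to the fifth power: T⁴ from the exponential sums and one more T from the
  -- weight 1/k.
  obtain ⟨C₀, hC₀, hT⟩ := exists_log_divisor_bound (ε / 5) (by positivity)
  refine ⟨3300 * C₀ ^ 5, by positivity, fun β hβ N f d a q hN hd hdN hfd hq haq happ => ?_⟩
  have hC5 : 1 ≤ C₀ ^ 5 := one_le_pow₀ hC₀
  have hN1 : (1 : ℝ) ≤ N := by exact_mod_cast (by omega : 1 ≤ N)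
  have hNε : 1 ≤ (N : ℝ) ^ ε := Real.one_le_rpow hN1 hε.le
  have hE0 := expSumError_nonneg N q d
  have hEN := le_mul_of_one_le_left hE0 hNε
  have hbase : 3300 * ((N : ℝ) ^ ε * expSumError N q d + β) ≤
      3300 * C₀ ^ 5 * ((N : ℝ) ^ ε * expSumError N q d + β) := by
    have : 0 ≤ (N : ℝ) ^ ε * expSumError N q d + β := by positivity
    nlinarith
  -- For q > N the term N^(1/2) q^(1/2) already exceeds N.
  rcases lt_or_ge N q with hqN | hqN
  · refine (abs_beattyPrimeSum_sub_le_primeSum α β hα N f d).trans ((primeSum_le N f d).trans ?_)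
    have h1 : (N : ℝ) ≤ expSumError N q d := by
      have h2 : (N : ℝ) = (N : ℝ) ^ (1 / 2 : ℝ) * (N : ℝ) ^ (1 / 2 : ℝ) := by
        rw [← Real.rpow_add (by positivity)]; norm_num
      have h3 : (N : ℝ) ^ (1 / 2 : ℝ) * (N : ℝ) ^ (1 / 2 : ℝ) ≤
          (N : ℝ) ^ (1 / 2 : ℝ) * (q : ℝ) ^ (1 / 2 : ℝ) := by gcongr
      have h4 : (0 : ℝ) ≤ (N : ℝ) / (q : ℝ) ^ (1 / 2 : ℝ) := by positivity
      have h5 : (0 : ℝ) ≤ (N : ℝ) ^ (3 / 4 : ℝ) * (d : ℝ) ^ (1 / 2 : ℝ) := by positivity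
      have h6 : (0 : ℝ) ≤ (N : ℝ) ^ (4 / 5 : ℝ) / (d : ℝ) ^ (1 / 5 : ℝ) := by positivity
      unfold expSumError
      linarith
    linarith
  · have hdN' : d ≤ N := by
      have h1 : (d : ℝ) ≤ N := hdN.trans
        ((Real.rpow_le_rpow_of_exponent_le hN1 (by norm_num)).trans_eq (Real.rpow_one _))
      exact_mod_cast h1
    obtain ⟨hT1, hT2, hT3⟩ := hT N hN
    set T := C₀ * (N : ℝ) ^ (ε / 5) with hTdef
    have hD : ∀ H, 0 < H → H ≤ N ^ 2 → ExpSumData (1 / α) N f d a q H T := fun H hH hHN =>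
      { irr := by rw [one_div]; exact hirr.inv
        two_le_N := hN
        d_pos := hd
        d_le := hdN'
        coprime_f := hfd
        q_pos := hq
        q_le := hqN
        coprime_a := haq
        approx := happ
        H_pos := hH
        H_le := hHN
        log_le := hT1
        natLog_le := hT2
        divisors_le := hT3 }
    have hTone : 1 ≤ T := (hD 1 one_pos (Nat.one_le_pow _ _ (by omega))).one_le_T
    have h1 := sum_div_le_of_sum_le (fun k => ‖primeExpSum N f d (1 / α * k)‖)
      (802 * T ^ 4 * expSumError N q d) (by positivity) (N ^ 2)
      (fun H hH hHN => (hD H hH hHN).sum_norm_primeExpSum_le hdN)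
    have h2 : 2 + Real.log ((N ^ 2 : ℕ) : ℝ) ≤ 2 * T := by
      push_cast
      rw [Real.log_pow]
      push_cast
      linarith
    have h3 : 802 * T ^ 4 * expSumError N q d * (2 + Real.log ((N ^ 2 : ℕ) : ℝ)) ≤
        802 * T ^ 4 * expSumError N q d * (2 * T) := by gcongr
    have h4 := abs_beattyPrimeSum_sub_le α β hα hβ N f d (by omega) _ (h1.trans h3)
    refine h4.trans ?_
    have h5 : T ^ 5 = C₀ ^ 5 * (N : ℝ) ^ ε := by
      rw [hTdef, mul_pow, ← Real.rpow_natCast ((N : ℝ) ^ (ε / 5)), ← Real.rpow_mul (by positivity)]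
      congr 2; push_cast; ring
    have h6 : 802 * T ^ 4 * expSumError N q d * (2 * T) =
        1604 * (C₀ ^ 5 * ((N : ℝ) ^ ε * expSumError N q d)) := by
      calc _ = 1604 * (T ^ 5 * expSumError N q d) := by ring
        _ = _ := by rw [h5]; ring
    rw [h6]
    have h7 : 1 ≤ expSumError N q d :=
      (Real.one_le_sqrt.2 hN1).trans (sqrt_le_expSumError N q d (by omega) hd)
    have h8 : 1 ≤ C₀ ^ 5 * ((N : ℝ) ^ ε * expSumError N q d) :=
      one_le_mul_of_one_le_of_one_le hC5 (h7.trans hEN)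
    have h9 : β ≤ C₀ ^ 5 * β := le_mul_of_one_le_left hβ hC5
    nlinarith

/-! ### Rational approximation of numbers of finite type -/

/-- A number of finite type `t` satisfies `‖nγ‖ ≫ n ^ (-t - δ)`. -/
theorem IsOfFiniteType.exists_le_rpow_mul {γ t : ℝ} (h : IsOfFiniteType γ t) {δ : ℝ} (hδ : 0 < δ) :
    ∃ c : ℝ, 0 < c ∧ ∀ n : ℕ, 0 < n → c ≤ (n : ℝ) ^ (t + δ) * distNearestInt ((n : ℝ) * γ) := by
  have hpos : ∀ n : ℕ, 0 < n → 0 < (n : ℝ) ^ (t + δ) * distNearestInt ((n : ℝ) * γ) := by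
    intro n hn
    have h1 : 0 < distNearestInt ((n : ℝ) * γ) :=
      distNearestInt_pos (h.1.natCast_mul hn.ne')
    have : (0 : ℝ) < n := by exact_mod_cast hn
    positivity
  have hne : liminf (fun n : ℕ => ENNReal.ofReal ((n : ℝ) ^ (t + δ) *
      distNearestInt ((n : ℝ) * γ))) atTop ≠ 0 := by
    intro h0
    have := h.2.1 (show t + δ ∈ _ from h0)
    linarith
  obtain ⟨b, hb0, hb⟩ := exists_between (pos_iff_ne_zero.2 hne)
  obtain ⟨n₀, hn₀⟩ := eventually_atTop.1 (eventually_lt_of_lt_liminf hb)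
  have hbtop : b ≠ ⊤ := (lt_of_lt_of_le hb le_top).ne
  have hb' : 0 < b.toReal := ENNReal.toReal_pos hb0.ne' hbtop
  -- A positive lower limit handles all large n; for the finitely many others irrationality makes
  -- the minimum positive.
  obtain ⟨m, hm, hmin⟩ := Finset.exists_min_image (Finset.Icc 1 (n₀ + 1))
    (fun n : ℕ => (n : ℝ) ^ (t + δ) * distNearestInt ((n : ℝ) * γ)) ⟨1, by simp⟩
  refine ⟨min b.toReal ((m : ℝ) ^ (t + δ) * distNearestInt ((m : ℝ) * γ)),
    lt_min hb' (hpos m (Finset.mem_Icc.1 hm).1), fun n hn => ?_⟩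
  rcases le_total n₀ n with hle | hle
  · refine (min_le_left _ _).trans ?_
    have h1 := ENNReal.toReal_mono ENNReal.ofReal_ne_top (hn₀ n hle).le
    rwa [ENNReal.toReal_ofReal (hpos n hn).le] at h1
  · exact (min_le_right _ _).trans (hmin n (Finset.mem_Icc.2 ⟨hn, by omega⟩))

/-- By Dirichlet some k ≤ Q has ‖kγ‖ ≤ 1/Q. If t < ρ < 1, the lower bound from the type would give c
≤ Q^(ρ - 1) for all Q, which tends to 0. -/
theorem IsOfFiniteType.one_le {γ t : ℝ} (h : IsOfFiniteType γ t) : 1 ≤ t := by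
  by_contra hlt
  rw [not_le] at hlt
  obtain ⟨ρ, hρ0, hρ1, hρt⟩ : ∃ ρ : ℝ, 0 < ρ ∧ ρ < 1 ∧ t < ρ := by
    obtain ⟨ρ, h1, h2⟩ := exists_between (max_lt hlt one_pos)
    exact ⟨ρ, (le_max_right _ _).trans_lt h1, h2, (le_max_left _ _).trans_lt h1⟩
  obtain ⟨c, hc, hcn⟩ := h.exists_le_rpow_mul (sub_pos.2 hρt)
  rw [add_sub_cancel] at hcn
  have hbound : ∀ Q : ℕ, 0 < Q → c ≤ (Q : ℝ) ^ (-(1 - ρ)) := by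
    intro Q hQ
    have hQ' : (0 : ℝ) < Q := by exact_mod_cast hQ
    obtain ⟨k, hk, hkQ, hdist⟩ := Real.exists_nat_abs_mul_sub_round_le γ hQ
    have h1 := hcn k hk
    have h2 : distNearestInt (k * γ) ≤ 1 / Q :=
      hdist.trans (one_div_le_one_div_of_le hQ' (by linarith))
    calc c ≤ (k : ℝ) ^ ρ * distNearestInt (k * γ) := h1
      _ ≤ (Q : ℝ) ^ ρ * (1 / Q) := by
          have := distNearestInt_nonneg (k * γ)
          gcongr
      _ = (Q : ℝ) ^ (-(1 - ρ)) := by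
          rw [one_div, ← Real.rpow_neg_one, ← Real.rpow_add hQ']
          congr 1; ring
  have htend : Tendsto (fun Q : ℕ => (Q : ℝ) ^ (-(1 - ρ))) atTop (nhds 0) :=
    (tendsto_rpow_neg_atTop (sub_pos.2 hρ1)).comp tendsto_natCast_atTop_atTop
  have := ge_of_tendsto htend (eventually_atTop.2 ⟨1, fun Q hQ => hbound Q hQ⟩)
  linarith

/-- Dirichlet's approximation theorem for a positive number of finite type, with a denominator that
is neither too large nor too small. -/
theorem IsOfFiniteType.exists_approx {γ t : ℝ} (h : IsOfFiniteType γ t) (hγ : 0 < γ) {δ : ℝ}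
    (hδ : 0 < δ) : ∃ c : ℝ, 0 < c ∧ ∀ x : ℝ, 1 ≤ x → ∃ a q : ℕ, 0 < q ∧ Nat.Coprime a q ∧
      |γ - (a : ℝ) / q| ≤ 1 / (q : ℝ) ^ 2 ∧ (q : ℝ) ≤ x ∧ c * x ^ (1 / (t + δ)) ≤ q := by
  obtain ⟨c, hc, hcn⟩ := h.exists_le_rpow_mul hδ
  have ht := h.one_le
  have htδ : 0 < t + δ := by linarith
  refine ⟨c ^ (1 / (t + δ)), by positivity, fun x hx => ?_⟩
  have hQ : 0 < ⌊x⌋₊ := Nat.floor_pos.2 hx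
  obtain ⟨r, hr, hrQ⟩ := Real.exists_rat_abs_sub_le_and_den_le γ hQ
  have hq0 : 0 < r.den := r.den_pos
  have hq0' : (0 : ℝ) < r.den := by exact_mod_cast hq0
  have hQx : x < (⌊x⌋₊ : ℝ) + 1 := Nat.lt_floor_add_one x
  have hqQ : (r.den : ℝ) ≤ ⌊x⌋₊ := by exact_mod_cast hrQ
  have hrcast : (r : ℝ) = (r.num : ℝ) / r.den := by
    exact_mod_cast (Rat.num_div_den r).symm
  -- A negative fraction would be at distance greater than 1/q from γ > 0, contradicting the
  -- approximation.
  have hnum : 0 ≤ r.num := by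
    by_contra hneg
    have h1 : (r.num : ℝ) ≤ -1 := by exact_mod_cast (by omega : r.num ≤ -1)
    have h2 : (r : ℝ) ≤ -1 / r.den := by rw [hrcast]; gcongr
    have h3 : 1 / ((⌊x⌋₊ + 1 : ℝ) * r.den) ≤ 1 / r.den := by
      apply one_div_le_one_div_of_le hq0'
      have : (0 : ℝ) ≤ ⌊x⌋₊ := by positivity
      nlinarith
    have h4 := (le_abs_self _).trans hr
    rw [neg_div] at h2
    linarith
  obtain ⟨a, ha⟩ := Int.eq_ofNat_of_zero_le hnum
  have hra : (r : ℝ) = (a : ℝ) / r.den := by rw [hrcast, ha]; simp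
  rw [hra] at hr
  refine ⟨a, r.den, hq0, ?_, hr.trans ?_, hqQ.trans (Nat.floor_le (by linarith)), ?_⟩
  · have := r.reduced
    rwa [ha] at this
  · apply one_div_le_one_div_of_le (by positivity)
    nlinarith
  -- Dirichlet gives ‖qγ‖ ≤ 1/x, while the type gives ‖qγ‖ ≥ c q^(-t-δ); together q^(t+δ) ≥ cx.
  · have h1 : distNearestInt (r.den * γ) ≤ 1 / x := by
      refine (distNearestInt_le _ (a : ℤ)).trans ?_
      have e : (r.den : ℝ) * γ - ((a : ℤ) : ℝ) = r.den * (γ - a / r.den) := by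
        field_simp; push_cast; ring
      rw [e, abs_mul, abs_of_pos hq0']
      calc _ ≤ (r.den : ℝ) * (1 / ((⌊x⌋₊ + 1 : ℝ) * r.den)) := by gcongr
        _ = 1 / (⌊x⌋₊ + 1 : ℝ) := by field_simp
        _ ≤ _ := one_div_le_one_div_of_le (by linarith) hQx.le
    have h2 : c ≤ (r.den : ℝ) ^ (t + δ) * (1 / x) :=
      (hcn r.den hq0).trans (by gcongr)
    have h3 : c * x ≤ (r.den : ℝ) ^ (t + δ) := by
      rw [mul_one_div, le_div_iff₀ (by linarith)] at h2
      exact h2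
    rw [← Real.mul_rpow hc.le (by linarith)]
    calc (c * x) ^ (1 / (t + δ)) ≤ ((r.den : ℝ) ^ (t + δ)) ^ (1 / (t + δ)) :=
          Real.rpow_le_rpow (by positivity) h3 (by positivity)
      _ = r.den := by
          rw [← Real.rpow_mul hq0'.le, mul_one_div_cancel htδ.ne', Real.rpow_one]

/-- Level N^(t/(t+1)) balances the two terms in q: the upper bound on q gives (Nq)^(1/2) ≤ N^(1 -
1/(2(1+t))), and the lower bound gives the same exponent for N/q^(1/2) up to ε. -/
theorem exists_expSumError_le_of_isOfFiniteType {γ t : ℝ} (h : IsOfFiniteType γ t) (hγ : 0 < γ)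
    (ε : ℝ) (hε : 0 < ε) : ∃ C : ℝ, 1 ≤ C ∧ ∀ N d : ℕ, 1 ≤ N → ∃ a q : ℕ, 0 < q ∧
      Nat.Coprime a q ∧ |γ - (a : ℝ) / q| ≤ 1 / (q : ℝ) ^ 2 ∧
      expSumError N q d ≤ C * ((N : ℝ) ^ (1 - 1 / (2 * (1 + t)) + ε)
        + (N : ℝ) ^ (3 / 4 : ℝ) * (d : ℝ) ^ (1 / 2 : ℝ)
        + (N : ℝ) ^ (4 / 5 : ℝ) * (d : ℝ) ^ (-(1 / 5) : ℝ)) := by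
  have ht := h.one_le
  obtain ⟨c, hc, happ⟩ := h.exists_approx hγ hε
  set C₁ : ℝ := c ^ (-(1 / 2) : ℝ) with hC₁
  have hC₁0 : 0 < C₁ := by positivity
  refine ⟨1 + C₁, by linarith, fun N d hN => ?_⟩
  have hN1 : (1 : ℝ) ≤ N := by exact_mod_cast hN
  have hN0 : (0 : ℝ) < N := by linarith
  obtain ⟨a, q, hq, hcop, hap, hqx, hqc⟩ := happ ((N : ℝ) ^ (t / (t + 1)))
    (Real.one_le_rpow hN1 (by positivity))
  refine ⟨a, q, hq, hcop, hap, ?_⟩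
  have hq0 : (0 : ℝ) < q := by exact_mod_cast hq
  set M : ℝ := (N : ℝ) ^ (1 - 1 / (2 * (1 + t)) + ε) with hM
  have hM0 : 0 ≤ M := by positivity
  have h1 : (N : ℝ) ^ (1 / 2 : ℝ) * (q : ℝ) ^ (1 / 2 : ℝ) ≤ M := by
    calc _ ≤ (N : ℝ) ^ (1 / 2 : ℝ) * ((N : ℝ) ^ (t / (t + 1))) ^ (1 / 2 : ℝ) := by gcongr
      _ = (N : ℝ) ^ (1 - 1 / (2 * (1 + t))) := by
          rw [← Real.rpow_mul hN0.le, ← Real.rpow_add hN0]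
          congr 1
          field_simp
          ring
      _ ≤ M := Real.rpow_le_rpow_of_exponent_le hN1 (by linarith)
  have h2 : (N : ℝ) / (q : ℝ) ^ (1 / 2 : ℝ) ≤ C₁ * M := by
    have h3 : (c * ((N : ℝ) ^ (t / (t + 1))) ^ (1 / (t + ε))) ^ (1 / 2 : ℝ) ≤
        (q : ℝ) ^ (1 / 2 : ℝ) := Real.rpow_le_rpow (by positivity) hqc (by norm_num)
    calc _ ≤ (N : ℝ) / (c * ((N : ℝ) ^ (t / (t + 1))) ^ (1 / (t + ε))) ^ (1 / 2 : ℝ) :=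
          div_le_div_of_nonneg_left hN0.le (by positivity) h3
      _ = C₁ * (N : ℝ) ^ (1 - t / (t + 1) * (1 / (t + ε)) * (1 / 2)) := by
          rw [Real.mul_rpow hc.le (by positivity), ← Real.rpow_mul hN0.le, ← Real.rpow_mul hN0.le,
            Real.rpow_sub hN0, Real.rpow_one, hC₁, Real.rpow_neg hc.le]
          field_simp
      _ ≤ C₁ * M := by
          refine mul_le_mul_of_nonneg_left (Real.rpow_le_rpow_of_exponent_le hN1 ?_) hC₁0.le
          have h4 : 1 / (2 * (1 + t)) - t / (t + 1) * (1 / (t + ε)) * (1 / 2) =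
              ε / (2 * (1 + t) * (t + ε)) := by
            field_simp
            ring
          have h5 : ε / (2 * (1 + t) * (t + ε)) ≤ ε := by
            apply div_le_self hε.le
            nlinarith
          linarith
  have h6 : (N : ℝ) ^ (4 / 5 : ℝ) / (d : ℝ) ^ (1 / 5 : ℝ) =
      (N : ℝ) ^ (4 / 5 : ℝ) * (d : ℝ) ^ (-(1 / 5) : ℝ) := by
    rw [Real.rpow_neg (Nat.cast_nonneg d), div_eq_mul_inv]
  have h7 : 0 ≤ (N : ℝ) ^ (3 / 4 : ℝ) * (d : ℝ) ^ (1 / 2 : ℝ) := by positivity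
  have h8 : 0 ≤ (N : ℝ) ^ (4 / 5 : ℝ) * (d : ℝ) ^ (-(1 / 5) : ℝ) := by positivity
  unfold expSumError
  rw [h6]
  nlinarith

/-! ### The two formulas -/

theorem theorem3 (α : ℝ) (hα : 1 < α) (hirr : Irrational α) :
    (∀ ε : ℝ, 0 < ε → ∃ C : ℝ, 0 < C ∧
      ∀ β : ℝ, 0 ≤ β → ∀ N f d a q : ℕ, 3 ≤ N → 1 ≤ f → f < d →
        (d : ℝ) ≤ min ((q : ℝ) ^ (1 / 2 : ℝ)) ((N : ℝ) ^ (1 / 6 : ℝ)) →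
        Nat.Coprime f d → Nat.Coprime a q →
        |1 / α - (a : ℝ) / (q : ℝ)| ≤ 1 / (q : ℝ) ^ 2 →
        |beattyPrimeSum α β N f d - 1 / α * primeSum N f d| ≤
          C * ((N : ℝ) ^ ε *
            ((N : ℝ) / (q : ℝ) ^ (1 / 2 : ℝ)
              + (N : ℝ) ^ (1 / 2 : ℝ) * (q : ℝ) ^ (1 / 2 : ℝ)
              + (N : ℝ) ^ (3 / 4 : ℝ) * (d : ℝ) ^ (1 / 2 : ℝ)
              + (N : ℝ) ^ (4 / 5 : ℝ) / (d : ℝ) ^ (1 / 5 : ℝ)) + β)) ∧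
    (∀ t : ℝ, IsOfFiniteType (1 / α) t →
      ∀ ε : ℝ, 0 < ε → ε < 1 / (4 * (t + 1)) → ∃ C : ℝ, 0 < C ∧
        ∀ β : ℝ, 0 ≤ β → ∀ N f d : ℕ, 3 ≤ N → 1 ≤ f → f < d →
          (d : ℝ) ≤ min ((N : ℝ) ^ (1 / (2 * (t + 1)))) ((N : ℝ) ^ (1 / 6 : ℝ)) →
          Nat.Coprime f d →
          |beattyPrimeSum α β N f d - 1 / α * primeSum N f d| ≤
            C * ((N : ℝ) ^ (1 - 1 / (2 * (1 + t)) + ε)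
              + (N : ℝ) ^ (3 / 4 + ε) * (d : ℝ) ^ (1 / 2 : ℝ)
              + (N : ℝ) ^ (4 / 5 + ε) * (d : ℝ) ^ (-(1 / 5) : ℝ) + β)) := by

  have hα0 : 0 < α := by linarith
  refine ⟨fun ε hε => ?_, fun t ht ε hε _ => ?_⟩
  · obtain ⟨C, hC, hmain⟩ := exists_abs_beattyPrimeSum_sub_le α hα hirr ε hε
    refine ⟨C, hC, fun β hβ N f d a q hN hf hfd hd hcop hcoq happ => ?_⟩
    -- For q = 0 both divisions by zero are 0 in Lean, so the approximation hypothesis would read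
    -- |1/α| ≤ 0.
    have hq : 0 < q := by
      rcases Nat.eq_zero_or_pos q with rfl | hq
      · exfalso
        have h1 : |1 / α| ≤ 0 := by simpa using happ
        have h2 : 0 < |1 / α| := by positivity
        linarith
      · exact hq
    exact hmain β hβ N f d a q (by omega) (by omega) (hd.trans (min_le_right _ _)) hcop hq hcoq happ
  -- Half of ε is spent on the factor N^ε of the first formula, the other half on the choice of q.
  · obtain ⟨C, hC, hmain⟩ := exists_abs_beattyPrimeSum_sub_le α hα hirr (ε / 2) (by positivity)
    obtain ⟨C₁, hC₁, hq⟩ := exists_expSumError_le_of_isOfFiniteType ht (by positivity) (ε / 2)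
      (by positivity)
    refine ⟨C * C₁, by positivity, fun β hβ N f d hN hf hfd hd hcop => ?_⟩
    obtain ⟨a, q, hq0, hcoq, happ, hE⟩ := hq N d (by omega)
    have hN1 : (1 : ℝ) ≤ N := by exact_mod_cast (by omega : 1 ≤ N)
    have hN0 : (0 : ℝ) < N := by linarith
    have h1 := hmain β hβ N f d a q (by omega) (by omega) (hd.trans (min_le_right _ _)) hcop hq0
      hcoq happ
    refine h1.trans ?_
    rw [mul_assoc]
    refine mul_le_mul_of_nonneg_left ?_ hC.le
    have h2 : (N : ℝ) ^ (ε / 2) * ((N : ℝ) ^ (1 - 1 / (2 * (1 + t)) + ε / 2)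
        + (N : ℝ) ^ (3 / 4 : ℝ) * (d : ℝ) ^ (1 / 2 : ℝ)
        + (N : ℝ) ^ (4 / 5 : ℝ) * (d : ℝ) ^ (-(1 / 5) : ℝ)) ≤
        (N : ℝ) ^ (1 - 1 / (2 * (1 + t)) + ε)
          + (N : ℝ) ^ (3 / 4 + ε) * (d : ℝ) ^ (1 / 2 : ℝ)
          + (N : ℝ) ^ (4 / 5 + ε) * (d : ℝ) ^ (-(1 / 5) : ℝ) := by
      rw [mul_add, mul_add, ← mul_assoc, ← mul_assoc, ← Real.rpow_add hN0, ← Real.rpow_add hN0,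
        ← Real.rpow_add hN0]
      have hle : ∀ x y : ℝ, x ≤ y → (N : ℝ) ^ x ≤ (N : ℝ) ^ y :=
        fun x y hxy => Real.rpow_le_rpow_of_exponent_le hN1 hxy
      exact add_le_add (add_le_add (hle _ _ (by linarith))
        (mul_le_mul_of_nonneg_right (hle _ _ (by linarith)) (by positivity)))
        (mul_le_mul_of_nonneg_right (hle _ _ (by linarith)) (by positivity))
    have h3 : (N : ℝ) ^ (ε / 2) * expSumError N q d ≤ C₁ * ((N : ℝ) ^ (1 - 1 / (2 * (1 + t)) + ε)
          + (N : ℝ) ^ (3 / 4 + ε) * (d : ℝ) ^ (1 / 2 : ℝ)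
          + (N : ℝ) ^ (4 / 5 + ε) * (d : ℝ) ^ (-(1 / 5) : ℝ)) := by
      calc _ ≤ (N : ℝ) ^ (ε / 2) * (C₁ * ((N : ℝ) ^ (1 - 1 / (2 * (1 + t)) + ε / 2)
            + (N : ℝ) ^ (3 / 4 : ℝ) * (d : ℝ) ^ (1 / 2 : ℝ)
            + (N : ℝ) ^ (4 / 5 : ℝ) * (d : ℝ) ^ (-(1 / 5) : ℝ))) := by gcongr
        _ = C₁ * ((N : ℝ) ^ (ε / 2) * ((N : ℝ) ^ (1 - 1 / (2 * (1 + t)) + ε / 2)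
            + (N : ℝ) ^ (3 / 4 : ℝ) * (d : ℝ) ^ (1 / 2 : ℝ)
            + (N : ℝ) ^ (4 / 5 : ℝ) * (d : ℝ) ^ (-(1 / 5) : ℝ))) := by ring
        _ ≤ _ := by gcongr
    have h4 : β ≤ C₁ * β := le_mul_of_one_le_left hβ hC₁
    rw [mul_add C₁ _ β]
    linarith
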